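/- Let $H$ be a complex Hilbert space of finite dimension $d$, let $X$ be a compact Hausdorff space with Borel $\sigma$-algebra $\mathcal B(X)$, and let $\mathcal B(H)_+$ be the cone of positive operators on $H$. Let $\nu:\mathcal B(X)\to\mathcal B(H)_+$ be a quantum probability measure, i.e. a countably additive map with $\nu(X)=1\neq 0$. Put $\mu=\frac1d\operatorname{tr}\circ\nu$, and let $D=\frac{d\nu}{d\mu}:X\to\mathcal B(H)$ be the ($\mu$-a.e. positive) Radon–Nikodým derivative, obtained by differentiating the matrix entries of $\nu$ in an orthonormal basis. A state is a positive operator of trace $1$. A quantum random variable is a function $\psi:X\to\mathcal B(H)$ such that $x\mapsto\operatorname{tr}(\rho\psi(x))$ is measurable for every state $\rho$. It is $\nu$-integrable if, for every state $\rho$, the function $\psi_\rho(x)=\operatorname{tr}\big(\rho D(x)^{1/2}\psi(x)D(x)^{1/2}\big)$ is $\mu$-integrable; then $\mathbb E_\nu[\psi]=\int_X\psi\,d\nu$ is the unique operator with $\operatorname{tr}\big(\rho\,\mathbb E_\nu[\psi]\big)=\int_X\psi_\rho\,d\mu$ for every state $\rho$. A conditional expectation on $\mathcal B(H)$ is an idempotent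 unital completely positive linear map $\mathcal B(H)\to\mathcal B(H)$; a unital quantum channel is a unital, trace-preserving, completely positive linear map. Then the following hold. 1. (Generalised linearity) If $\psi_1,\psi_2$ are $\nu$-integrable quantum random variables and $\varrho_1,\varrho_2\in\mathcal B(H)$ commute with $D(x)$ for $\mu$-almost every $x$, then $\varrho_1\psi_1+\varrho_2\psi_2$ is $\nu$-integrable and $\mathbb E_\nu[\varrho_1\psi_1+\varrho_2\psi_2]=\varrho_1\mathbb E_\nu[\psi_1]+\varrho_2\mathbb E_\nu[\psi_2]$. 2. (Monotonicity) If $\psi$ is a $\nu$-integrable quantum random variable and $\psi(x)\in\mathcal B(H)_+$ for $\mu$-almost all $x$, then $\mathbb E_\nu[\psi]\in\mathcal B(H)_+$. 3. (Additivity) If $\psi$ is a $\nu$-integrable quantum random variable and $E,F\subseteq X$ are disjoint Borel sets, then $\chi_{E\cup F}\psi$, $\chi_E\psi$, $\chi_F\psi$ are $\nu$-integrable and $\mathbb E_\nu[\chi_{E\cup F}\psi]=\mathbb E_\nu[\chi_E\psi]+\mathbb E_\nu[\chi_F\psi]$. 4. (Finitely supported measures) If $x_1,\dots,x_n\in X$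 are distinct, $\nu(X\setminus\{x_1,\dots,x_n\})=0$ and $h_j=\nu(\{x_j\})$, then every quantum random variable $\psi$ is $\nu$-integrable and $\mathbb E_\nu[\psi]=\sum_{j=1}^n h_j^{1/2}\psi(x_j)h_j^{1/2}$. 5. (Complete positivity) Every continuous $f:X\to\mathcal B(H)$ is $\nu$-integrable, and $\phi_\nu(f)=\int_X f\,d\nu$ defines a unital completely positive linear map $\phi_\nu:C(X)\otimes\mathcal B(H)=C(X,\mathcal B(H))\to\mathcal B(H)$. 6. (Jensen's inequality) Let $J\subseteq\mathbb R$ be an open interval containing $[\alpha,\beta]$, let $\psi$ be a quantum random variable such that every $\psi(x)$ is selfadjoint with spectrum in $[\alpha,\beta]$, and let $\vartheta:J\to\mathbb R$ be operator convex, i.e. $\vartheta(tA+(1-t)B)\le t\vartheta(A)+(1-t)\vartheta(B)$ for all $t\in[0,1]$ and all selfadjoint complex matrices $A,B$ of equal (arbitrary) size with spectra in $J$. Then $\psi$ and $\vartheta\circ\psi$ are $\nu$-integrable, $\int_X\psi\,d\nu$ is selfadjoint with spectrum in $[\alpha,\beta]$, and $\vartheta\big(\int_X\psi\,d\nu\big)\le\int_X\vartheta\circ\psi\,d\nu$.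 7. (Constant functions) Constant functions are $\nu$-integrable, and $\mathcal E_\nu(z)=\int_X z\,d\nu$ defines a unital quantum channel $\mathcal E_\nu:\mathcal B(H)\to\mathcal B(H)$; hence $\mathbb E_\nu[\rho]$ is a state for every state $\rho$. 8. (Fixed points) $\mathcal A_\nu=\{z\in\mathcal B(H):\mathbb E_\nu[z]=z\}$ is a unital C$^*$-subalgebra of $\mathcal B(H)$. 9. (Ergodic property) There is a trace-preserving conditional expectation $\mathfrak E_\nu:\mathcal B(H)\to\mathcal B(H)$ with range $\mathcal A_\nu$ such that $\lim_{N\to\infty}\frac1N\big(\mathcal I+\sum_{j=1}^{N-1}\mathcal E_\nu^{\,j}\big)=\mathfrak E_\nu$, where $\mathcal E_\nu^{\,j}$ is the $j$-fold composition and the limit is in norm. -/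

import Mathlib

open MeasureTheory Filter Topology
open scoped CStarAlgebra ComplexOrder

noncomputable section

namespace QuantumExpectation

section Operators

variable {H : Type*} [NormedAddCommGroup H] [InnerProductSpace ℂ H]

/-- The canonical trace `tr : B(H) → ℂ` (used for finite-dimensional `H`). -/
def opTrace : (H →L[ℂ] H) →ₗ[ℂ] ℂ :=
  LinearMap.trace ℂ H ∘ₗ ContinuousLinearMap.coeLM ℂ

/-- Density operators (states): positive operators of trace one. -/
def IsState (ρ : H →L[ℂ] H) : Prop := 0 ≤ ρ ∧ opTrace ρ = 1

theorem opTrace_nonneg [FiniteDimensional ℂ H] {a : H →L[ℂ] H} (ha : 0 ≤ a) :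
    0 ≤ opTrace a := by
  rw [ContinuousLinearMap.nonneg_iff_isPositive] at ha
  exact ha.toLinearMap.trace_nonneg

theorem opTrace_re_nonneg [FiniteDimensional ℂ H] {a : H →L[ℂ] H} (ha : 0 ≤ a) :
    0 ≤ (opTrace a).re :=
  (Complex.le_def.mp (opTrace_nonneg ha)).1

theorem continuous_opTrace [FiniteDimensional ℂ H] :
    Continuous (opTrace : (H →L[ℂ] H) →ₗ[ℂ] ℂ) :=
  LinearMap.continuous_of_finiteDimensional _

theorem opTrace_mul_rankOne [FiniteDimensional ℂ H] (a : H →L[ℂ] H) (v w : H) :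
    opTrace (a * InnerProductSpace.rankOne ℂ v w) = inner ℂ w (a v) := by
  have h : a * InnerProductSpace.rankOne ℂ v w = InnerProductSpace.rankOne ℂ (a v) w := by
    ext z
    simp [InnerProductSpace.rankOne_apply]
  rw [h]
  exact InnerProductSpace.trace_rankOne (a v) w

theorem opTrace_mul_comm (a b : H →L[ℂ] H) : opTrace (a * b) = opTrace (b * a) :=
  LinearMap.trace_mul_comm ℂ (a : H →ₗ[ℂ] H) (b : H →ₗ[ℂ] H)

end Operators

section Measures

/-- The real linear functional `a ↦ (1/d) Re tr a` on `B(H)`, where `d = dim H`. On positive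
operators the trace is real, so there it is `(1/d) tr a`. -/
def normTrace {H : Type*} [NormedAddCommGroup H] [InnerProductSpace ℂ H] : (H →L[ℂ] H) →+ ℝ :=
  (AddMonoidHom.mulLeft ((Module.finrank ℂ H : ℝ)⁻¹)).comp
    (Complex.reAddGroupHom.comp (opTrace : (H →L[ℂ] H) →ₗ[ℂ] ℂ).toAddMonoidHom)

theorem continuous_normTrace {H : Type*} [NormedAddCommGroup H] [InnerProductSpace ℂ H]
    [FiniteDimensional ℂ H] : Continuous (normTrace : (H →L[ℂ] H) →+ ℝ) :=
  continuous_const.mul (Complex.continuous_re.comp continuous_opTrace)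

variable (X : Type*) [MeasurableSpace X]
  (H : Type*) [NormedAddCommGroup H] [InnerProductSpace ℂ H] [CompleteSpace H]
  [FiniteDimensional ℂ H]

/-- Positive operator valued measures: countably additive, values positive operators, `ν X ≠ 0`.
Since `H` has finite dimension, the σ-weak topology of `B(H)` is the norm topology, which is the
topology used by `VectorMeasure`. (A `VectorMeasure` takes the value `0` on nonmeasurable sets
by convention.) -/
structure POVM extends VectorMeasure X (H →L[ℂ] H) where
  nonneg' : ∀ E : Set X, MeasurableSet E → 0 ≤ measureOf' E
  univ_ne_zero' : measureOf' Set.univ ≠ 0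

variable {X H}

instance : CoeFun (POVM X H) (fun _ => Set X → (H →L[ℂ] H)) := ⟨fun ν => ν.toVectorMeasure⟩

/-- A quantum probability measure is a positive operator valued measure with `ν X = 1`. -/
def POVM.IsProbability (ν : POVM X H) : Prop := ν Set.univ = 1

theorem zero_le_restrict_normTrace (ν : POVM X H) :
    VectorMeasure.restrict 0 Set.univ ≤
      VectorMeasure.restrict (ν.toVectorMeasure.mapRange normTrace continuous_normTrace)
        Set.univ := by
  refine VectorMeasure.restrict_le_restrict_of_subset_le _ _ fun E hE _ => ?_
  exact mul_nonneg (inv_nonneg.mpr (Nat.cast_nonneg _)) (opTrace_re_nonneg (ν.nonneg' E hE))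

/-- The induced measure `μ = (1/d) tr ∘ ν`, where `d = dim H`. -/
def POVM.traceMeasure (ν : POVM X H) : Measure X :=
  SignedMeasure.toMeasureOfZeroLE (ν.toVectorMeasure.mapRange normTrace continuous_normTrace)
    Set.univ MeasurableSet.univ (zero_le_restrict_normTrace ν)

/-- The complex measure `E ↦ ⟨e i, ν(E) (e j)⟩`, an entry of the matrix of `ν` in a fixed
orthonormal basis of `H`. -/
def POVM.entry (ν : POVM X H) (i j : Fin (Module.finrank ℂ H)) : ComplexMeasure X :=
  ν.toVectorMeasure.mapRange
    ((innerSL ℂ (stdOrthonormalBasis ℂ H i)).comp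
      (ContinuousLinearMap.apply ℂ H (stdOrthonormalBasis ℂ H j)) :
        (H →L[ℂ] H) →L[ℂ] ℂ).toLinearMap.toAddMonoidHom
    (ContinuousLinearMap.continuous _)

/-- The Radon-Nikodym derivative `dν/dμ : X → B(H)`: its matrix entries are the Radon-Nikodym
derivatives of the entries of `ν` with respect to `μ = (1/d) tr ∘ ν`. -/
def POVM.rnDeriv (ν : POVM X H) (x : X) : H →L[ℂ] H :=
  ∑ i, ∑ j, (ν.entry i j).rnDeriv ν.traceMeasure x •
    InnerProductSpace.rankOne ℂ (stdOrthonormalBasis ℂ H i) (stdOrthonormalBasis ℂ H j)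

/-- Quantum random variables: `x ↦ tr (ρ ψ(x))` is measurable for every state `ρ`. -/
def IsQuantumRandomVariable (ψ : X → (H →L[ℂ] H)) : Prop :=
  ∀ ρ : H →L[ℂ] H, IsState ρ → Measurable fun x => opTrace (ρ * ψ x)

/-- The function `ψ_ρ(x) = tr (ρ (dν/dμ)(x)^{1/2} ψ(x) (dν/dμ)(x)^{1/2})`. -/
def POVM.stateFun (ν : POVM X H) (ψ : X → (H →L[ℂ] H)) (ρ : H →L[ℂ] H) (x : X) : ℂ :=
  opTrace (ρ * (CFC.sqrt (ν.rnDeriv x) * ψ x * CFC.sqrt (ν.rnDeriv x)))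

/-- A quantum random variable `ψ` is `ν`-integrable if `ψ_ρ` is `μ`-integrable for every
state `ρ`. -/
def POVM.IsIntegrable (ν : POVM X H) (ψ : X → (H →L[ℂ] H)) : Prop :=
  IsQuantumRandomVariable ψ ∧
    ∀ ρ : H →L[ℂ] H, IsState ρ → Integrable (ν.stateFun ψ ρ) ν.traceMeasure

/-- `T` is the integral of `ψ` with respect to `ν`: `tr (ρ T) = ∫ ψ_ρ dμ` for every state `ρ`. -/
def POVM.IsIntegral (ν : POVM X H) (ψ : X → (H →L[ℂ] H)) (T : H →L[ℂ] H) : Prop :=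
  ∀ ρ : H →L[ℂ] H, IsState ρ → opTrace (ρ * T) = ∫ x, ν.stateFun ψ ρ x ∂ν.traceMeasure

/-- The states span `B(H)`. -/
theorem span_isState : Submodule.span ℂ {ρ : H →L[ℂ] H | IsState ρ} = ⊤ := by
  rw [eq_top_iff, ← CStarAlgebra.span_nonneg, Submodule.span_le]
  intro a ha
  have ha' : (0 : H →L[ℂ] H) ≤ a := ha
  have htr := opTrace_nonneg ha'
  by_cases h0 : opTrace a = 0
  · have hp := (ContinuousLinearMap.nonneg_iff_isPositive a).mp ha'
    have : a = 0 := by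
      have hm := LinearMap.posSemidef_toMatrix_iff (stdOrthonormalBasis ℂ H) |>.mpr hp.toLinearMap
      have h1 : (LinearMap.toMatrix (stdOrthonormalBasis ℂ H).toBasis
          (stdOrthonormalBasis ℂ H).toBasis (a : H →ₗ[ℂ] H)).trace = 0 := by
        rw [← LinearMap.trace_eq_matrix_trace]
        exact h0
      have h2 := hm.trace_eq_zero_iff.mp h1
      have h3 : (a : H →ₗ[ℂ] H) = 0 := by simpa using h2
      exact ContinuousLinearMap.coe_injective h3
    rw [this]
    exact Submodule.zero_mem _
  · have : a = opTrace a • ((opTrace a)⁻¹ • a) := by rw [smul_inv_smul₀ h0]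
    rw [this]
    refine Submodule.smul_mem _ _ (Submodule.subset_span ⟨?_, ?_⟩)
    · exact smul_nonneg (by simpa using htr) ha'
    · simp [h0]

/-- The integral of a `ν`-integrable quantum random variable exists and is unique. -/
theorem POVM.existsUnique_isIntegral (ν : POVM X H) {ψ : X → (H →L[ℂ] H)}
    (hψ : ν.IsIntegrable ψ) : ∃! T, ν.IsIntegral ψ T := by
  have hadd : ∀ (a b : H →L[ℂ] H) x,
      ν.stateFun ψ (a + b) x = ν.stateFun ψ a x + ν.stateFun ψ b x := by
    intro a b x
    simp only [POVM.stateFun, add_mul, map_add]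
  have hsmul : ∀ (c : ℂ) (a : H →L[ℂ] H) x,
      ν.stateFun ψ (c • a) x = c * ν.stateFun ψ a x := by
    intro c a x
    simp only [POVM.stateFun, smul_mul_assoc, map_smul, smul_eq_mul]
  have hint : ∀ a : H →L[ℂ] H, Integrable (ν.stateFun ψ a) ν.traceMeasure := by
    intro a
    have ha : a ∈ Submodule.span ℂ {ρ : H →L[ℂ] H | IsState ρ} := by
      rw [span_isState]
      exact Submodule.mem_top
    induction ha using Submodule.span_induction with
    | mem ρ h => exact hψ.2 ρ h
    | zero =>
      have : ν.stateFun ψ 0 = 0 := by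
        ext x
        simp [POVM.stateFun]
      rw [this]
      exact integrable_zero _ _ _
    | add a b _ _ iha ihb =>
      rw [show ν.stateFun ψ (a + b) = ν.stateFun ψ a + ν.stateFun ψ b from funext (hadd a b)]
      exact iha.add ihb
    | smul c a _ iha =>
      rw [show ν.stateFun ψ (c • a) = fun x => c * ν.stateFun ψ a x from funext (hsmul c a)]
      exact iha.const_mul c
  let L : (H →L[ℂ] H) →ₗ[ℂ] ℂ :=
    { toFun := fun a => ∫ x, ν.stateFun ψ a x ∂ν.traceMeasure
      map_add' := fun a b => by
        simp only [hadd]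
        exact integral_add (hint a) (hint b)
      map_smul' := fun c a => by
        simp only [hsmul, integral_const_mul, RingHom.id_apply, smul_eq_mul] }
  let e := stdOrthonormalBasis ℂ H
  let T : H →L[ℂ] H :=
    ∑ i, ∑ j, L (InnerProductSpace.rankOne ℂ (e j) (e i)) • InnerProductSpace.rankOne ℂ (e i) (e j)
  have hexp : ∀ a : H →L[ℂ] H,
      a = ∑ i, ∑ j, inner ℂ (e j) (a (e i)) • InnerProductSpace.rankOne ℂ (e j) (e i) := by
    intro a
    refine ContinuousLinearMap.coe_injective (e.toBasis.ext fun k => ?_)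
    simp only [ContinuousLinearMap.coe_coe, OrthonormalBasis.coe_toBasis,
      FunLike.coe_sum, Finset.sum_apply, FunLike.coe_smul,
      Pi.smul_apply, InnerProductSpace.rankOne_apply]
    rw [Finset.sum_comm]
    simp only [orthonormal_iff_ite.mp e.orthonormal, ite_smul, one_smul, zero_smul, smul_ite,
      smul_zero, Finset.sum_ite_eq', Finset.mem_univ, if_true]
    exact (e.sum_repr' (a (e k))).symm
  have hT : ∀ ρ : H →L[ℂ] H, opTrace (ρ * T) = L ρ := by
    intro ρ
    conv_rhs => rw [hexp ρ]
    simp only [T, Finset.mul_sum, map_sum, mul_smul_comm, map_smul, opTrace_mul_rankOne,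
      smul_eq_mul]
    exact Finset.sum_congr rfl fun i _ => Finset.sum_congr rfl fun j _ => mul_comm _ _
  refine ⟨T, fun ρ _ => hT ρ, fun S hS => ?_⟩
  have hS' : ∀ a : H →L[ℂ] H, opTrace (S * a) = opTrace (T * a) := by
    intro a
    have ha : a ∈ Submodule.span ℂ {ρ : H →L[ℂ] H | IsState ρ} := by
      rw [span_isState]
      exact Submodule.mem_top
    induction ha using Submodule.span_induction with
    | mem ρ h => rw [opTrace_mul_comm S, opTrace_mul_comm T, hT ρ]; exact hS ρ h
    | zero => simp
    | add a b _ _ iha ihb => simp only [mul_add, map_add, iha, ihb]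
    | smul c a _ iha => simp only [mul_smul_comm, map_smul, iha]
  ext v
  refine ext_inner_left ℂ fun w => ?_
  rw [← opTrace_mul_rankOne, ← opTrace_mul_rankOne, hS']

open Classical in
/-- The integral `∫ ψ dν`: for `ν`-integrable `ψ`, the unique operator `T` with
`tr (ρ T) = ∫ ψ_ρ dμ` for every state `ρ` (and `0` by convention otherwise). -/
def POVM.integral (ν : POVM X H) (ψ : X → (H →L[ℂ] H)) : H →L[ℂ] H :=
  if h : ν.IsIntegrable ψ then (ν.existsUnique_isIntegral h).choose else 0

/-- The quantum expectation `E_ν[ψ] = ∫ ψ dν` (for a quantum probability measure `ν`). -/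
abbrev POVM.expectation (ν : POVM X H) (ψ : X → (H →L[ℂ] H)) : H →L[ℂ] H := ν.integral ψ

/-- `ν` is supported on a set `S`: the complement of `S` has `ν`-measure zero. -/
def POVM.IsSupportedOn (ν : POVM X H) (S : Set X) : Prop := ν Sᶜ = 0

/-- The set `A_ν` of all `z ∈ B(H)` with `E_ν[z] = z`. -/
def POVM.fixedPoints (ν : POVM X H) : Set (H →L[ℂ] H) :=
  {z | ν.expectation (fun _ => z) = z}

end Measures

section Maps

/-- The continuous square root on the positive cone of `B(H)`. Its only purpose is to make
`C(X, B(H))`, with the pointwise order, a star-ordered ring, so that Mathlib's completely positive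
maps apply to that C⋆-algebra. -/
instance instContinuousSqrtOperators {H : Type*} [NormedAddCommGroup H] [InnerProductSpace ℂ H]
    [CompleteSpace H] :
    ContinuousSqrt (H →L[ℂ] H) where
  sqrt p := CFC.sqrt (p.2 - p.1)
  continuousOn_sqrt :=
    CFC.continuousOn_sqrt.comp (continuous_snd.sub continuous_fst).continuousOn
      fun p hp => (sub_nonneg.mpr hp : 0 ≤ p.2 - p.1)
  sqrt_nonneg _ _ := CFC.sqrt_nonneg _
  sqrt_mul_sqrt p hp := by
    rw [CFC.sqrt_mul_sqrt_self _ (sub_nonneg.mpr hp), add_sub_cancel]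

/-- The function `φ : A → B` between unital C⋆-algebras is a unital completely positive linear
map. -/
def IsUnitalCompletelyPositive {A B : Type*} [CStarAlgebra A] [CStarAlgebra B] [PartialOrder A]
    [PartialOrder B] [StarOrderedRing A] [StarOrderedRing B] (φ : A → B) : Prop :=
  ∃ Φ : A →CP B, (∀ a, Φ a = φ a) ∧ Φ 1 = 1

variable {H : Type*} [NormedAddCommGroup H] [InnerProductSpace ℂ H] [CompleteSpace H]

/-- Unital quantum channels on `B(H)`, `H` finite-dimensional: unital, completely positive, trace
preserving linear maps. -/
def IsUnitalQuantumChannel (φ : (H →L[ℂ] H) → (H →L[ℂ] H)) : Prop :=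
  IsUnitalCompletelyPositive φ ∧ ∀ z, opTrace (φ z) = opTrace z

/-- Conditional expectations on `B(H)`: idempotent unital completely positive linear maps. -/
def IsConditionalExpectation (φ : (H →L[ℂ] H) → (H →L[ℂ] H)) : Prop :=
  IsUnitalCompletelyPositive φ ∧ ∀ z, φ (φ z) = φ z

/-- `ϑ` is operator convex on `J ⊆ ℝ`: for all selfadjoint matrices `A`, `B` (of any size) with
spectrum in `J` and all `t ∈ [0, 1]`, `ϑ(tA + (1-t)B) ≤ t ϑ(A) + (1-t) ϑ(B)`, where `ϑ(A)` is
given by the functional calculus. -/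
def OperatorConvexOn (J : Set ℝ) (ϑ : ℝ → ℝ) : Prop :=
  ∀ (n : ℕ) (A B : EuclideanSpace ℂ (Fin n) →L[ℂ] EuclideanSpace ℂ (Fin n)),
    IsSelfAdjoint A → IsSelfAdjoint B → spectrum ℝ A ⊆ J → spectrum ℝ B ⊆ J →
    ∀ t : ℝ, 0 ≤ t → t ≤ 1 →
      cfc ϑ (t • A + (1 - t) • B) ≤ t • cfc ϑ A + (1 - t) • cfc ϑ B

end Maps

end QuantumExpectation

end

/-! Write `D` for `ν.rnDeriv` and `s = D^{1/2}`. The states span `B(H)` and `H` has finite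
dimension, so measurability and integrability tested on states are those of operator-valued
functions, and the expectation is the Bochner integral of `s ψ s` against `μ` (`POVM.integral_eq`).
From `ν(E) ≤ tr ν(E) · 1 = d μ(E) · 1` one gets `0 ≤ D ≤ d · 1` almost everywhere, hence every
bounded measurable `ψ` is integrable. Conjugation by `s` preserves positivity, also for matrices
over `B(H)`, and so does integration; linearity, monotonicity and complete positivity follow.

Fixed points: the map `z ↦ E[z]` is symmetric for the trace pairing, so it preserves the trace
because it is unital. If `E[z] = z`, the integral of `tr |s z - z s|²` equals `tr(z z*) - 2 tr(z*
E[z]) + tr(z* z) = 0`. The fixed points are thus the operators commuting with almost every `s(x)`,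
which form a star-algebra.

Ergodic property: a positive unital map has bounded orbits, so the mean ergodic theorem makes the
averages converge to a projection onto the fixed points; complete positivity and trace preservation
pass to the limit.

Jensen: averaging `A` with its conjugate by a reflection gives `ϑ(V*AV) ≤ V*ϑ(A)V` for isometries
`V`. For block-diagonal `A` this is the inequality for finite sums `∑ b_i* a_i b_i` with `∑ b_i* b_i
= 1`. The integrals `∫ sψs`, `∫ sϑ(ψ)s` and `∫ s²` form a point in the convex hull of a compact set,
so they are simultaneously finite sums of this kind, and no approximation is needed. -/

set_option linter.unusedSectionVars false

noncomputable section

namespace QuantumExpectation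

/-! ### Trace pairings and the Bochner form of the integral -/

section TraceFunctionals

variable {X : Type*} [MeasurableSpace X]
  {H : Type*} [NormedAddCommGroup H] [InnerProductSpace ℂ H] [CompleteSpace H]
  [FiniteDimensional ℂ H]

/-- An operator is determined by its trace pairings with rank-one operators. -/
theorem eq_sum_opTrace_smul_rankOne (a : H →L[ℂ] H) :
    a = ∑ i, ∑ j, opTrace (InnerProductSpace.rankOne ℂ (stdOrthonormalBasis ℂ H j)
        (stdOrthonormalBasis ℂ H i) * a) •
      InnerProductSpace.rankOne ℂ (stdOrthonormalBasis ℂ H i) (stdOrthonormalBasis ℂ H j) := by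
  set e := stdOrthonormalBasis ℂ H
  refine ContinuousLinearMap.coe_injective (e.toBasis.ext fun k => ?_)
  simp only [opTrace_mul_comm _ a, opTrace_mul_rankOne]
  simp only [ContinuousLinearMap.coe_coe, OrthonormalBasis.coe_toBasis,
    FunLike.coe_sum, Finset.sum_apply, FunLike.coe_smul,
    Pi.smul_apply, InnerProductSpace.rankOne_apply]
  simp only [orthonormal_iff_ite.mp e.orthonormal, ite_smul, one_smul, zero_smul, smul_ite,
    smul_zero, Finset.sum_ite_eq', Finset.mem_univ, if_true]
  exact (e.sum_repr' (a (e k))).symm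

/-- A property of operators that holds for states and is compatible with linear combinations
holds for all operators. -/
theorem induction_isState {p : (H →L[ℂ] H) → Prop} (hs : ∀ ρ, IsState ρ → p ρ) (h0 : p 0)
    (hadd : ∀ a b, p a → p b → p (a + b)) (hsmul : ∀ (c : ℂ) a, p a → p (c • a))
    (a : H →L[ℂ] H) : p a := by
  have ha : a ∈ Submodule.span ℂ {ρ : H →L[ℂ] H | IsState ρ} := by
    rw [span_isState]
    exact Submodule.mem_top
  induction ha using Submodule.span_induction with
  | mem ρ h => exact hs ρ h
  | zero => exact h0
  | add a b _ _ iha ihb => exact hadd a b iha ihb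
  | smul c a _ iha => exact hsmul c a iha

theorem continuous_opTrace_mul (ρ : H →L[ℂ] H) :
    Continuous fun a : H →L[ℂ] H => opTrace (ρ * a) :=
  continuous_opTrace.comp (continuous_const.mul continuous_id)

/-- The functional `a ↦ tr (ρ a)` as a continuous linear map. -/
def opTraceMulL (ρ : H →L[ℂ] H) : (H →L[ℂ] H) →L[ℂ] ℂ :=
  ⟨opTrace ∘ₗ LinearMap.mulLeft ℂ ρ, continuous_opTrace_mul ρ⟩

theorem eq_of_forall_isState_opTrace {S T : H →L[ℂ] H}
    (h : ∀ ρ : H →L[ℂ] H, IsState ρ → opTrace (ρ * S) = opTrace (ρ * T)) : S = T := by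
  have h' : ∀ a : H →L[ℂ] H, opTrace (a * S) = opTrace (a * T) := by
    refine induction_isState h (by simp) ?_ ?_
    · intro a b ha hb
      simp only [add_mul, map_add, ha, hb]
    · intro c a ha
      simp only [smul_mul_assoc, map_smul, ha]
  rw [eq_sum_opTrace_smul_rankOne S, eq_sum_opTrace_smul_rankOne T]
  simp only [h']

/-- The matrix entries of `ψ x` are trace pairings with rank-one operators, which are linear
combinations of states. -/
theorem isQuantumRandomVariable_iff_measurable {ψ : X → (H →L[ℂ] H)} :
    IsQuantumRandomVariable ψ ↔ Measurable ψ := by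
  refine ⟨fun h => ?_, fun h ρ _ => (continuous_opTrace_mul ρ).measurable.comp h⟩
  have h' : ∀ a : H →L[ℂ] H, Measurable fun x => opTrace (a * ψ x) := by
    refine induction_isState h (by simp) ?_ ?_
    · intro a b ha hb
      simp only [add_mul, map_add]
      exact ha.add hb
    · intro c a ha
      simp only [smul_mul_assoc, map_smul]
      exact ha.const_smul c
  have : ψ = fun x => _ := funext fun x => eq_sum_opTrace_smul_rankOne (ψ x)
  rw [this]
  exact Finset.measurable_sum _ fun i _ => Finset.measurable_sum _ fun j _ =>
    (h' _).smul_const _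

theorem integrable_iff_forall_isState_opTrace {f : X → (H →L[ℂ] H)} {μ : Measure X} :
    Integrable f μ ↔
      ∀ ρ : H →L[ℂ] H, IsState ρ → Integrable (fun x => opTrace (ρ * f x)) μ := by
  refine ⟨fun h ρ _ => (opTraceMulL ρ).integrable_comp h, fun h => ?_⟩
  have h' : ∀ a : H →L[ℂ] H, Integrable (fun x => opTrace (a * f x)) μ := by
    refine induction_isState h (by simp) ?_ ?_
    · intro a b ha hb
      simp only [add_mul, map_add]
      exact ha.add hb
    · intro c a ha
      simp only [smul_mul_assoc, map_smul]
      exact ha.smul c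
  have : f = fun x => _ := funext fun x => eq_sum_opTrace_smul_rankOne (f x)
  rw [this]
  exact integrable_finsetSum _ fun i _ => integrable_finsetSum _ fun j _ =>
    (h' _).smul_const _

/-- The operator-valued function `x ↦ (dν/dμ)(x)^{1/2} ψ(x) (dν/dμ)(x)^{1/2}`. -/
def POVM.sandwich (ν : POVM X H) (ψ : X → (H →L[ℂ] H)) (x : X) : H →L[ℂ] H :=
  CFC.sqrt (ν.rnDeriv x) * ψ x * CFC.sqrt (ν.rnDeriv x)

theorem POVM.isIntegrable_iff (ν : POVM X H) {ψ : X → (H →L[ℂ] H)} :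
    ν.IsIntegrable ψ ↔ Measurable ψ ∧ Integrable (ν.sandwich ψ) ν.traceMeasure := by
  rw [POVM.IsIntegrable, isQuantumRandomVariable_iff_measurable,
    integrable_iff_forall_isState_opTrace]
  rfl

/-- Replaces the weak definition through states by a Bochner integral: continuous functionals
commute with the integral, and states separate operators. -/
theorem POVM.integral_eq (ν : POVM X H) {ψ : X → (H →L[ℂ] H)} (hψ : ν.IsIntegrable ψ) :
    ν.integral ψ = ∫ x, ν.sandwich ψ x ∂ν.traceMeasure := by
  have h1 : ν.IsIntegral ψ (ν.integral ψ) := by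
    rw [POVM.integral, dif_pos hψ]
    exact (ν.existsUnique_isIntegral hψ).choose_spec.1
  refine eq_of_forall_isState_opTrace fun ρ hρ => ?_
  rw [h1 ρ hρ]
  exact (opTraceMulL ρ).integral_comp_comm (ν.isIntegrable_iff.mp hψ).2

end TraceFunctionals

/-! ### Positive operators and the trace -/

section Positivity

variable {H : Type*} [NormedAddCommGroup H] [InnerProductSpace ℂ H] [CompleteSpace H]
  [FiniteDimensional ℂ H]

theorem opTrace_mul_nonneg {a b : H →L[ℂ] H} (ha : 0 ≤ a) (hb : 0 ≤ b) :
    0 ≤ opTrace (a * b) := by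
  have h := star_left_conjugate_nonneg hb (CFC.sqrt a)
  rw [(CFC.sqrt_nonneg a).isSelfAdjoint.star_eq] at h
  rw [← CFC.sqrt_mul_sqrt_self a ha, mul_assoc, opTrace_mul_comm]
  exact opTrace_nonneg h

theorem opTrace_one : opTrace (1 : H →L[ℂ] H) = Module.finrank ℂ H :=
  LinearMap.trace_one ℂ H

/-- In the order of `ℂ`, being nonnegative includes being real, so the quadratic form also forces
self-adjointness. -/
theorem nonneg_iff_forall_inner {a : H →L[ℂ] H} :
    0 ≤ a ↔ ∀ v, 0 ≤ inner ℂ v (a v) := by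
  rw [ContinuousLinearMap.nonneg_iff_isPositive]
  refine ⟨fun h v => h.inner_nonneg_right v, fun h => ?_⟩
  rw [ContinuousLinearMap.isPositive_iff_complex]
  intro v
  have hv := h v
  rw [← inner_conj_symm, RCLike.star_def.symm, star_nonneg_iff] at hv
  exact ⟨(Complex.eq_re_of_ofReal_le (r := 0) (by simpa using hv)).symm, (Complex.le_def.mp hv).1⟩

/-- A positive operator is bounded by its trace. -/
theorem le_opTrace_smul_one {a : H →L[ℂ] H} (ha : 0 ≤ a) :
    a ≤ opTrace a • (1 : H →L[ℂ] H) := by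
  rw [← sub_nonneg, nonneg_iff_forall_inner]
  intro v
  -- Cauchy–Schwarz: the rank-one operator of `v` is at most `‖v‖² · 1`. Its trace pairing with `a`
  -- is `⟨v, a v⟩`.
  have hc : 0 ≤ (inner ℂ v v) • (1 : H →L[ℂ] H) - InnerProductSpace.rankOne ℂ v v := by
    rw [nonneg_iff_forall_inner]
    intro w
    simp only [FunLike.coe_sub, FunLike.coe_smul, Pi.sub_apply, Pi.smul_apply,
      one_apply_eq_self, InnerProductSpace.rankOne_apply, inner_sub_right,
      inner_smul_right]
    rw [sub_nonneg, ← inner_conj_symm v w, ← Complex.normSq_eq_conj_mul_self,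
      inner_self_eq_norm_sq_to_K, inner_self_eq_norm_sq_to_K, Complex.normSq_eq_norm_sq]
    have := norm_inner_le_norm (𝕜 := ℂ) w v
    have h2 : ‖inner ℂ w v‖ ^ 2 ≤ ‖v‖ ^ 2 * ‖w‖ ^ 2 := by
      calc ‖inner ℂ w v‖ ^ 2 ≤ (‖w‖ * ‖v‖) ^ 2 := by gcongr
        _ = _ := by ring
    exact Complex.real_le_real.mpr h2 |>.trans_eq (by push_cast; rfl)
  have := opTrace_mul_nonneg ha hc
  rw [mul_sub, map_sub, opTrace_mul_rankOne, mul_smul_comm, mul_one, map_smul] at this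
  simpa [inner_sub_right, inner_smul_right, mul_comm] using this

theorem opTrace_eq_re {a : H →L[ℂ] H} (ha : 0 ≤ a) : opTrace a = ((opTrace a).re : ℂ) := by
  have := opTrace_nonneg ha
  exact (Complex.eq_re_of_ofReal_le (r := 0) (by simpa using this))

theorem eq_zero_of_opTrace_eq_zero {a : H →L[ℂ] H} (ha : 0 ≤ a) (h : opTrace a = 0) : a = 0 := by
  have := le_opTrace_smul_one ha
  rw [h, zero_smul] at this
  exact le_antisymm this ha

end Positivity

/-! ### The derivative `D`: integrals, positivity and boundedness -/

section RadonNikodym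

variable {X : Type*} [MeasurableSpace X]
  {H : Type*} [NormedAddCommGroup H] [InnerProductSpace ℂ H] [CompleteSpace H]
  [FiniteDimensional ℂ H]

theorem POVM.nonneg (ν : POVM X H) (E : Set X) : 0 ≤ ν E := by
  by_cases hE : MeasurableSet E
  · exact ν.nonneg' E hE
  · rw [ν.toVectorMeasure.not_measurable hE]

theorem POVM.nontrivial (ν : POVM X H) : Nontrivial (H →L[ℂ] H) :=
  ⟨ν Set.univ, 0, ν.univ_ne_zero'⟩

instance (ν : POVM X H) : IsFiniteMeasure ν.traceMeasure := by
  unfold POVM.traceMeasure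
  infer_instance

theorem POVM.traceMeasure_real_apply (ν : POVM X H) {E : Set X} (hE : MeasurableSet E) :
    ν.traceMeasure.real E = (Module.finrank ℂ H : ℝ)⁻¹ * (opTrace (ν E)).re := by
  rw [POVM.traceMeasure, SignedMeasure.toMeasureOfZeroLE_real_apply _ _ _ hE, Set.univ_inter]
  rfl

theorem POVM.finrank_ne_zero (ν : POVM X H) : (Module.finrank ℂ H : ℝ) ≠ 0 := by
  have := ν.nontrivial
  intro h
  have h0 : Module.finrank ℂ H = 0 := by exact_mod_cast h
  have : Subsingleton H := Module.finrank_zero_iff.mp h0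
  exact not_subsingleton (H →L[ℂ] H) inferInstance

theorem POVM.opTrace_apply (ν : POVM X H) {E : Set X} (hE : MeasurableSet E) :
    opTrace (ν E) = ((Module.finrank ℂ H * ν.traceMeasure.real E : ℝ) : ℂ) := by
  rw [ν.traceMeasure_real_apply hE, mul_inv_cancel_left₀ ν.finrank_ne_zero,
    ← opTrace_eq_re (ν.nonneg E)]

theorem POVM.traceMeasure_eq_zero_iff (ν : POVM X H) {E : Set X} (hE : MeasurableSet E) :
    ν.traceMeasure E = 0 ↔ ν E = 0 := by
  rw [← measureReal_eq_zero_iff]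
  constructor
  · intro h
    refine eq_zero_of_opTrace_eq_zero (ν.nonneg E) ?_
    rw [ν.opTrace_apply hE, h]
    simp
  · intro h
    rw [ν.traceMeasure_real_apply hE, h]
    simp

theorem POVM.IsProbability.isProbabilityMeasure {ν : POVM X H} (hν : ν.IsProbability) :
    IsProbabilityMeasure ν.traceMeasure := by
  have h := ν.traceMeasure_real_apply MeasurableSet.univ
  rw [show ν Set.univ = 1 from hν, opTrace_one, Complex.natCast_re,
    inv_mul_cancel₀ ν.finrank_ne_zero] at h
  exact ⟨by rw [← ENNReal.toReal_eq_one_iff]; exact h⟩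

theorem POVM.entry_apply (ν : POVM X H) (i j : Fin (Module.finrank ℂ H)) (E : Set X) :
    ν.entry i j E = inner ℂ (stdOrthonormalBasis ℂ H i) (ν E (stdOrthonormalBasis ℂ H j)) := rfl

/-- The Radon–Nikodym theorem for signed measures, applied to the real and imaginary parts. -/
theorem _root_.MeasureTheory.ComplexMeasure.setIntegral_rnDeriv {c : ComplexMeasure X}
    {μ : Measure X} [SigmaFinite μ] (h : c ≪ᵥ μ.toENNRealVectorMeasure) {E : Set X}
    (hE : MeasurableSet E) : ∫ x in E, c.rnDeriv μ x ∂μ = c E := by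
  obtain ⟨hre, him⟩ := (ComplexMeasure.absolutelyContinuous_ennreal_iff c _).mp h
  have hi := (c.integrable_rnDeriv μ).integrableOn (s := E)
  apply Complex.ext
  · rw [← RCLike.re_eq_complex_re, ← integral_re hi]
    change ∫ x in E, c.re.rnDeriv μ x ∂μ = c.re E
    rw [← withDensityᵥ_apply (SignedMeasure.integrable_rnDeriv _ _) hE,
      SignedMeasure.withDensityᵥ_rnDeriv_eq _ _ hre]
  · rw [← RCLike.im_eq_complex_im, ← integral_im hi]
    change ∫ x in E, c.im.rnDeriv μ x ∂μ = c.im E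
    rw [← withDensityᵥ_apply (SignedMeasure.integrable_rnDeriv _ _) hE,
      SignedMeasure.withDensityᵥ_rnDeriv_eq _ _ him]

theorem POVM.setIntegral_entry_rnDeriv (ν : POVM X H) (i j : Fin (Module.finrank ℂ H))
    {E : Set X} (hE : MeasurableSet E) :
    ∫ x in E, (ν.entry i j).rnDeriv ν.traceMeasure x ∂ν.traceMeasure =
      inner ℂ (stdOrthonormalBasis ℂ H i) (ν E (stdOrthonormalBasis ℂ H j)) := by
  rw [ComplexMeasure.setIntegral_rnDeriv _ hE, ν.entry_apply]
  refine VectorMeasure.AbsolutelyContinuous.mk fun F hF h => ?_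
  rw [Measure.toENNRealVectorMeasure_apply_measurable hF, ν.traceMeasure_eq_zero_iff hF] at h
  rw [ν.entry_apply, h]
  simp

theorem POVM.integrable_rnDeriv (ν : POVM X H) : Integrable ν.rnDeriv ν.traceMeasure :=
  integrable_finsetSum _ fun _ _ => integrable_finsetSum _ fun _ _ =>
    (ComplexMeasure.integrable_rnDeriv _ _).smul_const _

theorem POVM.setIntegral_rnDeriv (ν : POVM X H) {E : Set X} (hE : MeasurableSet E) :
    ∫ x in E, ν.rnDeriv x ∂ν.traceMeasure = ν E := by
  have hi : ∀ i j, Integrable (fun x => (ν.entry i j).rnDeriv ν.traceMeasure x •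
      InnerProductSpace.rankOne ℂ (stdOrthonormalBasis ℂ H i) (stdOrthonormalBasis ℂ H j))
      (ν.traceMeasure.restrict E) := fun i j =>
    ((ComplexMeasure.integrable_rnDeriv _ _).smul_const _).integrableOn
  simp only [POVM.rnDeriv]
  rw [integral_finsetSum _ fun i _ => integrable_finsetSum _ fun j _ => hi i j]
  conv_rhs => rw [eq_sum_opTrace_smul_rankOne (ν E)]
  refine Finset.sum_congr rfl fun i _ => ?_
  rw [integral_finsetSum _ fun j _ => hi i j]
  refine Finset.sum_congr rfl fun j _ => ?_
  rw [integral_smul_const, ν.setIntegral_entry_rnDeriv i j hE, opTrace_mul_comm,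
    opTrace_mul_rankOne]

/-- An integrable operator-valued function with positive integrals over all measurable sets is
positive almost everywhere. -/
theorem ae_nonneg_of_forall_setIntegral_operator_nonneg {μ : Measure X}
    {f : X → (H →L[ℂ] H)} (hf : Integrable f μ)
    (h : ∀ E, MeasurableSet E → 0 ≤ ∫ x in E, f x ∂μ) : ∀ᵐ x ∂μ, 0 ≤ f x := by
  let q (v : H) : (H →L[ℂ] H) →L[ℂ] ℂ := (innerSL ℂ v).comp (ContinuousLinearMap.apply ℂ H v)
  have hq : ∀ v a, q v a = inner ℂ v (a v) := fun v a => rfl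
  have hqi : ∀ v, Integrable (fun x => q v (f x)) μ := fun v => (q v).integrable_comp hf
  have key : ∀ v, ∀ᵐ x ∂μ, 0 ≤ inner ℂ v (f x v) := by
    intro v
    have hE : ∀ E, MeasurableSet E → 0 ≤ ∫ x in E, q v (f x) ∂μ := by
      intro E hE
      rw [(q v).integral_comp_comm hf.integrableOn, hq]
      exact nonneg_iff_forall_inner.mp (h E hE) v
    have hre : ∀ᵐ x ∂μ, 0 ≤ (q v (f x)).re := by
      refine ae_nonneg_of_forall_setIntegral_nonneg (hqi v).re fun E hEm _ => ?_
      have := integral_re (𝕜 := ℂ) (hqi v).integrableOn (μ := μ.restrict E)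
      exact (Complex.le_def.mp (hE E hEm)).1.trans_eq this.symm
    have him : (fun x => (q v (f x)).im) =ᵐ[μ] 0 := by
      refine (hqi v).im.ae_eq_zero_of_forall_setIntegral_eq_zero fun E hEm _ => ?_
      have := integral_im (𝕜 := ℂ) (hqi v).integrableOn (μ := μ.restrict E)
      exact this.trans (Complex.le_def.mp (hE E hEm)).2.symm
    filter_upwards [hre, him] with x h1 h2
    exact Complex.le_def.mpr ⟨h1, h2.symm⟩
  -- The exceptional null set depends on `v`; a countable dense set of vectors gives a common one,
  -- and continuity in `v` does the rest.
  obtain ⟨s, hs, hsd⟩ := TopologicalSpace.exists_countable_dense H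
  have hall : ∀ᵐ x ∂μ, ∀ v ∈ s, 0 ≤ inner ℂ v (f x v) := (ae_ball_iff hs).mpr fun v _ => key v
  filter_upwards [hall] with x hx
  rw [nonneg_iff_forall_inner]
  have hcl : IsClosed {v : H | 0 ≤ inner ℂ v (f x v)} :=
    isClosed_le continuous_const (continuous_id.inner (f x).continuous)
  intro v
  exact hcl.closure_subset_iff.mpr hx (hsd v)

theorem POVM.ae_rnDeriv_nonneg (ν : POVM X H) : ∀ᵐ x ∂ν.traceMeasure, 0 ≤ ν.rnDeriv x :=
  ae_nonneg_of_forall_setIntegral_operator_nonneg ν.integrable_rnDeriv fun E hE => by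
    rw [ν.setIntegral_rnDeriv hE]
    exact ν.nonneg E

/-- Since `ν(E) ≤ tr ν(E) · 1 = d μ(E) · 1`, the function `d · 1 - D` has positive integral over
every measurable set. -/
theorem POVM.ae_rnDeriv_le (ν : POVM X H) :
    ∀ᵐ x ∂ν.traceMeasure, ν.rnDeriv x ≤ (Module.finrank ℂ H : ℂ) • (1 : H →L[ℂ] H) := by
  have h := ae_nonneg_of_forall_setIntegral_operator_nonneg
    ((integrable_const ((Module.finrank ℂ H : ℂ) • (1 : H →L[ℂ] H))).sub ν.integrable_rnDeriv)
    fun E hE => by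
      rw [Pi.sub_def, integral_sub (integrable_const _).integrableOn
        ν.integrable_rnDeriv.integrableOn, ν.setIntegral_rnDeriv hE, setIntegral_const, sub_nonneg]
      refine (le_opTrace_smul_one (ν.nonneg E)).trans_eq ?_
      rw [ν.opTrace_apply hE, ← Complex.coe_smul, smul_smul]
      push_cast
      rw [mul_comm]
  filter_upwards [h] with x hx
  exact sub_nonneg.mp hx

theorem POVM.sqrt_rnDeriv_isSelfAdjoint (ν : POVM X H) (x : X) :
    IsSelfAdjoint (CFC.sqrt (ν.rnDeriv x)) := (CFC.sqrt_nonneg _).isSelfAdjoint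

theorem POVM.ae_sqrt_mul_sqrt (ν : POVM X H) : ∀ᵐ x ∂ν.traceMeasure,
    CFC.sqrt (ν.rnDeriv x) * CFC.sqrt (ν.rnDeriv x) = ν.rnDeriv x := by
  filter_upwards [ν.ae_rnDeriv_nonneg] with x hx
  exact CFC.sqrt_mul_sqrt_self _ hx

theorem POVM.ae_norm_sqrt_le (ν : POVM X H) : ∀ᵐ x ∂ν.traceMeasure,
    ‖CFC.sqrt (ν.rnDeriv x)‖ ≤ √(Module.finrank ℂ H) := by
  have := ν.nontrivial
  filter_upwards [ν.ae_rnDeriv_nonneg, ν.ae_rnDeriv_le] with x hx hx'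
  apply Real.le_sqrt_of_sq_le
  have h1 : ‖ν.rnDeriv x‖ ≤ Module.finrank ℂ H := by
    refine (CStarAlgebra.norm_le_norm_of_nonneg_of_le hx hx').trans ?_
    rw [norm_smul, norm_one, mul_one, Complex.norm_natCast]
  have h2 := CStarRing.norm_star_mul_self (x := CFC.sqrt (ν.rnDeriv x))
  rw [(ν.sqrt_rnDeriv_isSelfAdjoint x).star_eq, CFC.sqrt_mul_sqrt_self _ hx] at h2
  rw [sq, ← h2]
  exact h1

theorem POVM.aestronglyMeasurable_sqrt (ν : POVM X H) :
    AEStronglyMeasurable (fun x => CFC.sqrt (ν.rnDeriv x)) ν.traceMeasure := by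
  classical
  -- The square root is continuous on the closed positive cone. Setting it to zero elsewhere makes
  -- it Borel, and `D` leaves the cone only on a null set.
  have hm : Measurable fun a : H →L[ℂ] H => if 0 ≤ a then CFC.sqrt a else 0 :=
    ContinuousOn.measurable_piecewise (s := {a : H →L[ℂ] H | 0 ≤ a}) CFC.continuousOn_sqrt
      continuousOn_const CStarAlgebra.isClosed_nonneg.measurableSet
  have h1 := (hm.comp_aemeasurable ν.integrable_rnDeriv.1.aemeasurable).aestronglyMeasurable
  refine h1.congr ?_
  filter_upwards [ν.ae_rnDeriv_nonneg] with x hx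
  simp [hx]

theorem POVM.integrable_sandwich_of_bounded (ν : POVM X H) {ψ : X → (H →L[ℂ] H)}
    (hψ : AEStronglyMeasurable ψ ν.traceMeasure) {C : ℝ} (hC : ∀ x, ‖ψ x‖ ≤ C) :
    Integrable (ν.sandwich ψ) ν.traceMeasure := by
  have hs := ν.aestronglyMeasurable_sqrt
  refine Integrable.of_bound ((hs.mul hψ).mul hs)
    (√(Module.finrank ℂ H) * C * √(Module.finrank ℂ H)) ?_
  filter_upwards [ν.ae_norm_sqrt_le] with x hx
  have hC0 := (norm_nonneg _).trans (hC x)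
  refine (norm_mul_le _ _).trans (mul_le_mul ((norm_mul_le _ _).trans
    (mul_le_mul hx (hC x) (norm_nonneg _) (Real.sqrt_nonneg _))) hx (norm_nonneg _) ?_)
  positivity

theorem POVM.isIntegrable_of_bounded (ν : POVM X H) {ψ : X → (H →L[ℂ] H)}
    (hψ : Measurable ψ) {C : ℝ} (hC : ∀ x, ‖ψ x‖ ≤ C) : ν.IsIntegrable ψ :=
  ν.isIntegrable_iff.mpr
    ⟨hψ, ν.integrable_sandwich_of_bounded hψ.aestronglyMeasurable hC⟩

theorem POVM.isIntegrable_const (ν : POVM X H) (z : H →L[ℂ] H) :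
    ν.IsIntegrable fun _ => z :=
  ν.isIntegrable_of_bounded measurable_const fun _ => le_rfl

theorem POVM.integral_const_one (ν : POVM X H) : ν.integral (fun _ => 1) = ν Set.univ := by
  rw [ν.integral_eq (ν.isIntegrable_const 1), ← ν.setIntegral_rnDeriv MeasurableSet.univ,
    Measure.restrict_univ]
  refine integral_congr_ae ?_
  filter_upwards [ν.ae_sqrt_mul_sqrt] with x hx
  rw [POVM.sandwich, mul_one, hx]

end RadonNikodym

/-! ### Linearity, additivity, atoms and fixed points of the expectation -/

section Expectation

variable {X : Type*} [MeasurableSpace X]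
  {H : Type*} [NormedAddCommGroup H] [InnerProductSpace ℂ H] [CompleteSpace H]
  [FiniteDimensional ℂ H]

/-- An operator commuting with `D(x)` commutes with its square root by the functional calculus, so
it slides out of the sandwich to the left. -/
theorem POVM.integral_generalised_linear (ν : POVM X H) {ψ₁ ψ₂ : X → (H →L[ℂ] H)}
    (h₁ : ν.IsIntegrable ψ₁) (h₂ : ν.IsIntegrable ψ₂) {ϱ₁ ϱ₂ : H →L[ℂ] H}
    (hc₁ : ∀ᵐ x ∂ν.traceMeasure, Commute ϱ₁ (ν.rnDeriv x))
    (hc₂ : ∀ᵐ x ∂ν.traceMeasure, Commute ϱ₂ (ν.rnDeriv x)) :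
    ν.IsIntegrable (fun x => ϱ₁ * ψ₁ x + ϱ₂ * ψ₂ x) ∧
      ν.integral (fun x => ϱ₁ * ψ₁ x + ϱ₂ * ψ₂ x) =
        ϱ₁ * ν.integral ψ₁ + ϱ₂ * ν.integral ψ₂ := by
  obtain ⟨hm₁, hi₁⟩ := ν.isIntegrable_iff.mp h₁
  obtain ⟨hm₂, hi₂⟩ := ν.isIntegrable_iff.mp h₂
  have hae : (fun x => ϱ₁ * ν.sandwich ψ₁ x + ϱ₂ * ν.sandwich ψ₂ x) =ᵐ[ν.traceMeasure]
      ν.sandwich (fun x => ϱ₁ * ψ₁ x + ϱ₂ * ψ₂ x) := by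
    filter_upwards [hc₁, hc₂] with x h1 h2
    have e1 : ϱ₁ * CFC.sqrt (ν.rnDeriv x) = CFC.sqrt (ν.rnDeriv x) * ϱ₁ :=
      (h1.symm.cfcₙ_nnreal _).eq.symm
    have e2 : ϱ₂ * CFC.sqrt (ν.rnDeriv x) = CFC.sqrt (ν.rnDeriv x) * ϱ₂ :=
      (h2.symm.cfcₙ_nnreal _).eq.symm
    simp only [POVM.sandwich, mul_add, add_mul, ← mul_assoc, e1, e2]
  have hint : ν.IsIntegrable (fun x => ϱ₁ * ψ₁ x + ϱ₂ * ψ₂ x) :=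
    ν.isIntegrable_iff.mpr ⟨(hm₁.const_mul _).add (hm₂.const_mul _),
      ((hi₁.const_mul _).add (hi₂.const_mul _)).congr hae⟩
  refine ⟨hint, ?_⟩
  rw [ν.integral_eq hint, ν.integral_eq h₁, ν.integral_eq h₂, ← integral_congr_ae hae,
    integral_add (hi₁.const_mul _) (hi₂.const_mul _), integral_const_mul_of_integrable hi₁,
    integral_const_mul_of_integrable hi₂]

theorem POVM.IsIntegrable.add {ν : POVM X H} {ψ₁ ψ₂ : X → (H →L[ℂ] H)}
    (h₁ : ν.IsIntegrable ψ₁) (h₂ : ν.IsIntegrable ψ₂) :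
    ν.IsIntegrable (fun x => ψ₁ x + ψ₂ x) := by
  simpa using (ν.integral_generalised_linear h₁ h₂ (.of_forall fun x => Commute.one_left _)
    (.of_forall fun x => Commute.one_left _)).1

theorem POVM.integral_add (ν : POVM X H) {ψ₁ ψ₂ : X → (H →L[ℂ] H)}
    (h₁ : ν.IsIntegrable ψ₁) (h₂ : ν.IsIntegrable ψ₂) :
    ν.integral (fun x => ψ₁ x + ψ₂ x) = ν.integral ψ₁ + ν.integral ψ₂ := by
  simpa using (ν.integral_generalised_linear h₁ h₂ (.of_forall fun x => Commute.one_left _)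
    (.of_forall fun x => Commute.one_left _)).2

theorem POVM.integral_smul (ν : POVM X H) {ψ : X → (H →L[ℂ] H)} (h : ν.IsIntegrable ψ) (c : ℂ) :
    ν.integral (fun x => c • ψ x) = c • ν.integral ψ := by
  have hc : ∀ᵐ x ∂ν.traceMeasure, Commute (c • (1 : H →L[ℂ] H)) (ν.rnDeriv x) :=
    .of_forall fun x => (Commute.one_left _).smul_left c
  have h0 : ∀ᵐ x ∂ν.traceMeasure, Commute (0 : H →L[ℂ] H) (ν.rnDeriv x) :=
    .of_forall fun x => Commute.zero_left _
  simpa using (ν.integral_generalised_linear h h hc h0).2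

theorem POVM.sandwich_nonneg (ν : POVM X H) {ψ : X → (H →L[ℂ] H)} {x : X} (h : 0 ≤ ψ x) :
    0 ≤ ν.sandwich ψ x := by
  have := star_left_conjugate_nonneg h (CFC.sqrt (ν.rnDeriv x))
  rwa [(ν.sqrt_rnDeriv_isSelfAdjoint x).star_eq] at this

theorem POVM.integral_nonneg (ν : POVM X H) {ψ : X → (H →L[ℂ] H)} (hψ : ν.IsIntegrable ψ)
    (h : ∀ᵐ x ∂ν.traceMeasure, 0 ≤ ψ x) : 0 ≤ ν.integral ψ := by
  rw [ν.integral_eq hψ]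
  refine integral_nonneg_of_ae ?_
  filter_upwards [h] with x hx
  exact ν.sandwich_nonneg hx

theorem POVM.sandwich_indicator (ν : POVM X H) (ψ : X → (H →L[ℂ] H)) (E : Set X) :
    ν.sandwich (E.indicator ψ) = E.indicator (ν.sandwich ψ) := by
  ext1 x
  by_cases hx : x ∈ E <;> simp [POVM.sandwich, hx]

theorem POVM.IsIntegrable.indicator {ν : POVM X H} {ψ : X → (H →L[ℂ] H)}
    (hψ : ν.IsIntegrable ψ) {E : Set X} (hE : MeasurableSet E) :
    ν.IsIntegrable (E.indicator ψ) := by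
  obtain ⟨hm, hi⟩ := ν.isIntegrable_iff.mp hψ
  rw [ν.isIntegrable_iff, ν.sandwich_indicator]
  exact ⟨hm.indicator hE, hi.indicator hE⟩

theorem POVM.integral_indicator_union (ν : POVM X H) {ψ : X → (H →L[ℂ] H)}
    (hψ : ν.IsIntegrable ψ) {E F : Set X} (hE : MeasurableSet E) (hF : MeasurableSet F)
    (hEF : E ∩ F = ∅) : ν.integral ((E ∪ F).indicator ψ) =
      ν.integral (E.indicator ψ) + ν.integral (F.indicator ψ) := by
  rw [Set.indicator_union_of_disjoint (Set.disjoint_iff_inter_eq_empty.mpr hEF)]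
  exact ν.integral_add (hψ.indicator hE) (hψ.indicator hF)

theorem POVM.sqrt_apply_singleton [MeasurableSingletonClass X] (ν : POVM X H) (x : X) :
    CFC.sqrt (ν {x}) = √(ν.traceMeasure.real {x}) • CFC.sqrt (ν.rnDeriv x) := by
  have h1 := ν.setIntegral_rnDeriv (MeasurableSet.singleton x)
  rw [integral_singleton] at h1
  rw [← h1]
  by_cases h0 : ν.traceMeasure.real {x} = 0
  · simp [h0]
  -- A point of nonzero mass cannot lie in the null set where `D` fails to be positive.
  have hpos : 0 ≤ ν.rnDeriv x := by
    by_contra hx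
    refine h0 ?_
    rw [measureReal_eq_zero_iff]
    exact measure_mono_null (by simpa using hx) (ae_iff.mp ν.ae_rnDeriv_nonneg)
  refine CFC.sqrt_unique ?_ (smul_nonneg (Real.sqrt_nonneg _) (CFC.sqrt_nonneg _))
  rw [smul_mul_smul_comm, CFC.sqrt_mul_sqrt_self _ hpos, Real.mul_self_sqrt measureReal_nonneg]

theorem POVM.integral_of_isSupportedOn_range [MeasurableSingletonClass X] (ν : POVM X H)
    {ψ : X → (H →L[ℂ] H)} (hψ : Measurable ψ) {n : ℕ} {x : Fin n → X}
    (hx : Function.Injective x) (hν : ν.IsSupportedOn (Set.range x)) :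
    ν.IsIntegrable ψ ∧
      ν.integral ψ = ∑ j, CFC.sqrt (ν {x j}) * ψ (x j) * CFC.sqrt (ν {x j}) := by
  classical
  let s : Finset X := Finset.univ.map ⟨x, hx⟩
  have hs : (s : Set X) = Set.range x := by simp [s]
  have hr : ν.traceMeasure.restrict s = ν.traceMeasure := by
    refine Measure.restrict_eq_self_of_ae_mem ?_
    rw [ae_iff, hs]
    exact (ν.traceMeasure_eq_zero_iff (Set.finite_range x).measurableSet.compl).mpr hν
  have hi : IntegrableOn (ν.sandwich ψ) s ν.traceMeasure := IntegrableOn.finset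
  have hint : ν.IsIntegrable ψ := ν.isIntegrable_iff.mpr ⟨hψ, by rwa [IntegrableOn, hr] at hi⟩
  refine ⟨hint, ?_⟩
  rw [ν.integral_eq hint, ← hr, setIntegral_finset s hi, Finset.sum_map]
  refine Finset.sum_congr rfl fun j _ => ?_
  rw [ν.sqrt_apply_singleton, smul_mul_assoc, smul_mul_smul_comm,
    Real.mul_self_sqrt measureReal_nonneg]
  rfl

theorem POVM.opTrace_mul_integral (ν : POVM X H) {ψ : X → (H →L[ℂ] H)} (hψ : ν.IsIntegrable ψ)
    (a : H →L[ℂ] H) :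
    opTrace (a * ν.integral ψ) = ∫ x, opTrace (a * ν.sandwich ψ x) ∂ν.traceMeasure := by
  rw [ν.integral_eq hψ]
  exact ((opTraceMulL a).integral_comp_comm (ν.isIntegrable_iff.mp hψ).2).symm

theorem POVM.integrable_opTrace_mul_sandwich (ν : POVM X H) {ψ : X → (H →L[ℂ] H)}
    (hψ : ν.IsIntegrable ψ) (a : H →L[ℂ] H) :
    Integrable (fun x => opTrace (a * ν.sandwich ψ x)) ν.traceMeasure :=
  (opTraceMulL a).integrable_comp (ν.isIntegrable_iff.mp hψ).2

/-- The map `z ↦ ∫ z dν` is symmetric for the trace pairing. -/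
theorem POVM.opTrace_mul_integral_const (ν : POVM X H) (a b : H →L[ℂ] H) :
    opTrace (a * ν.integral fun _ => b) = opTrace ((ν.integral fun _ => a) * b) := by
  rw [opTrace_mul_comm _ b, ν.opTrace_mul_integral (ν.isIntegrable_const b),
    ν.opTrace_mul_integral (ν.isIntegrable_const a)]
  -- Pointwise this is `tr(a s b s) = tr(b s a s)`, by cyclicity.
  refine integral_congr_ae (.of_forall fun x => ?_)
  simp only [POVM.sandwich]
  rw [← mul_assoc, opTrace_mul_comm, ← mul_assoc b, opTrace_mul_comm (b * _)]
  simp only [← mul_assoc]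
  rw [mul_assoc, opTrace_mul_comm]
  simp only [← mul_assoc]

theorem POVM.IsProbability.integral_one {ν : POVM X H} (hν : ν.IsProbability) :
    ν.integral (fun _ => 1) = 1 := by
  rw [ν.integral_const_one]
  exact hν

/-- Preserving the trace is dual to being unital: take `a = 1` in the symmetry of the trace pairing.
-/
theorem POVM.IsProbability.opTrace_integral_const {ν : POVM X H} (hν : ν.IsProbability)
    (z : H →L[ℂ] H) : opTrace (ν.integral fun _ => z) = opTrace z := by
  have := ν.opTrace_mul_integral_const 1 z
  rwa [hν.integral_one, one_mul, one_mul] at this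

/-- The commutator `c = s z - z s` is shown to vanish by integrating `tr(c* c)`, its squared
Hilbert–Schmidt norm. This description makes closure under products visible. -/
theorem POVM.IsProbability.mem_fixedPoints_iff {ν : POVM X H} (hν : ν.IsProbability)
    (z : H →L[ℂ] H) : z ∈ ν.fixedPoints ↔
      ∀ᵐ x ∂ν.traceMeasure, Commute (CFC.sqrt (ν.rnDeriv x)) z := by
  constructor
  · intro hz
    have hz' : ν.integral (fun _ => z) = z := hz
    let c : X → (H →L[ℂ] H) := fun x =>
      CFC.sqrt (ν.rnDeriv x) * z - z * CFC.sqrt (ν.rnDeriv x)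
    have hform : ∀ x, opTrace (star (c x) * c x) =
        opTrace ((z * star z) * ν.sandwich (fun _ => 1) x)
          - (2 : ℂ) * opTrace (star z * ν.sandwich (fun _ => z) x)
          + opTrace (1 * ν.sandwich (fun _ => star z * z) x) := by
      intro x
      simp only [c, POVM.sandwich, star_sub, star_mul, (ν.sqrt_rnDeriv_isSelfAdjoint x).star_eq]
      generalize CFC.sqrt (ν.rnDeriv x) = s
      have e1 : opTrace (star z * s * (s * z)) = opTrace (z * star z * (s * 1 * s)) := by
        rw [mul_one, mul_assoc z, opTrace_mul_comm z]
        simp only [mul_assoc]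
      have e2 : opTrace (s * star z * (s * z)) = opTrace (star z * (s * z * s)) := by
        rw [mul_assoc s, opTrace_mul_comm s]
        simp only [mul_assoc]
      have e3 : opTrace (star z * s * (z * s)) = opTrace (star z * (s * z * s)) := by
        simp only [mul_assoc]
      have e4 : opTrace (s * star z * (z * s)) = opTrace (1 * (s * (star z * z) * s)) := by
        simp only [mul_assoc, one_mul]
      rw [sub_mul, mul_sub, mul_sub]
      simp only [map_sub, e1, e2, e3, e4]
      ring
    have i1 := ν.integrable_opTrace_mul_sandwich (ν.isIntegrable_const 1) (z * star z)
    have i2 := ν.integrable_opTrace_mul_sandwich (ν.isIntegrable_const z) (star z)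
    have i3 := ν.integrable_opTrace_mul_sandwich (ν.isIntegrable_const (star z * z)) 1
    have hint : Integrable (fun x => opTrace (star (c x) * c x)) ν.traceMeasure := by
      simp only [hform]
      exact (i1.sub (i2.const_mul 2)).add i3
    -- The three terms integrate to `tr(z z*)`, `-2 tr(z* z)` and `tr(z* z)`: the second uses `E[z]
    -- = z`, the third trace preservation.
    have h0 : ∫ x, opTrace (star (c x) * c x) ∂ν.traceMeasure = 0 := by
      simp only [hform]
      have i12 : Integrable (fun x => opTrace ((z * star z) * ν.sandwich (fun _ => 1) x)
          - (2 : ℂ) * opTrace (star z * ν.sandwich (fun _ => z) x)) ν.traceMeasure :=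
        i1.sub (i2.const_mul 2)
      rw [MeasureTheory.integral_add i12 i3, integral_sub i1 (i2.const_mul 2),
        integral_const_mul, ← ν.opTrace_mul_integral (ν.isIntegrable_const 1),
        ← ν.opTrace_mul_integral (ν.isIntegrable_const z),
        ← ν.opTrace_mul_integral (ν.isIntegrable_const _), hν.integral_one, hz', one_mul, mul_one,
        hν.opTrace_integral_const, opTrace_mul_comm z]
      ring
    have hre0 : ∫ x, (opTrace (star (c x) * c x)).re ∂ν.traceMeasure = 0 := by
      have := integral_re (𝕜 := ℂ) hint
      rw [h0] at this
      simpa using this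
    have hae := (integral_eq_zero_iff_of_nonneg
      (fun x => opTrace_re_nonneg (star_mul_self_nonneg (c x))) hint.re).mp hre0
    filter_upwards [hae] with x hx
    have h1 := eq_zero_of_opTrace_eq_zero (star_mul_self_nonneg (c x)) (by
      rw [opTrace_eq_re (star_mul_self_nonneg (c x))]
      exact_mod_cast hx)
    exact sub_eq_zero.mp (CStarRing.star_mul_self_eq_zero_iff _ |>.mp h1)
  · intro hz
    have hone := ν.isIntegrable_iff.mp (ν.isIntegrable_const 1) |>.2
    have hae : ν.sandwich (fun _ => z) =ᵐ[ν.traceMeasure]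
        fun x => z * ν.sandwich (fun _ => 1) x := by
      filter_upwards [hz] with x hx
      simp only [POVM.sandwich, mul_one, hx.eq, mul_assoc]
    change ν.integral (fun _ => z) = z
    rw [ν.integral_eq (ν.isIntegrable_const z), integral_congr_ae hae,
      integral_const_mul_of_integrable hone, ← ν.integral_eq (ν.isIntegrable_const 1),
      hν.integral_one, mul_one]

/-- The fixed points of `z ↦ ∫ z dν` form a unital star-subalgebra. -/
def POVM.fixedPointsStarSubalgebra (ν : POVM X H) (hν : ν.IsProbability) :
    StarSubalgebra ℂ (H →L[ℂ] H) where
  carrier := ν.fixedPoints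
  mul_mem' {a b} ha hb := by
    rw [hν.mem_fixedPoints_iff] at *
    filter_upwards [ha, hb] with x h1 h2 using h1.mul_right h2
  add_mem' {a b} ha hb := by
    rw [hν.mem_fixedPoints_iff] at *
    filter_upwards [ha, hb] with x h1 h2 using h1.add_right h2
  algebraMap_mem' c := by
    rw [hν.mem_fixedPoints_iff]
    exact .of_forall fun x => (Algebra.commutes c _).symm
  star_mem' {a} ha := by
    rw [hν.mem_fixedPoints_iff] at *
    filter_upwards [ha] with x h1
    have := h1.star_star
    rwa [(ν.sqrt_rnDeriv_isSelfAdjoint x).star_eq] at this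

theorem POVM.isClosed_fixedPointsStarSubalgebra (ν : POVM X H) (hν : ν.IsProbability) :
    IsClosed (ν.fixedPointsStarSubalgebra hν : Set (H →L[ℂ] H)) :=
  (ν.fixedPointsStarSubalgebra hν).toSubalgebra.toSubmodule.closed_of_finiteDimensional

end Expectation

/-! ### Complete positivity of the integral -/

section CompletePositivity

/-- Entrywise conjugation by `s` is conjugation by the diagonal matrix with all diagonal entries
`s`. -/
theorem cstarMatrix_map_conj_nonneg {A : Type*} [CStarAlgebra A] [PartialOrder A]
    [StarOrderedRing A] {k : ℕ} {M : CStarMatrix (Fin k) (Fin k) A} (hM : 0 ≤ M) {s : A}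
    (hs : IsSelfAdjoint s) : 0 ≤ M.map fun z => s * z * s := by
  let D : CStarMatrix (Fin k) (Fin k) A := CStarMatrix.ofMatrix (Matrix.diagonal fun _ => s)
  have h := star_left_conjugate_nonneg hM D
  have e : star D * M * D = M.map fun z => s * z * s := by
    ext i j
    simp [D, CStarMatrix.mul_apply, CStarMatrix.star_apply, Matrix.diagonal_apply, hs.star_eq,
      apply_ite star]
  rwa [e] at h

theorem integral_cstarAlgebra_nonneg {X B : Type*} [MeasurableSpace X] {μ : Measure X}
    [CStarAlgebra B] [PartialOrder B] [StarOrderedRing B] {f : X → B} (h : ∀ x, 0 ≤ f x) :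
    0 ≤ ∫ x, f x ∂μ :=
  integral_nonneg h

theorem integral_cstarMatrix_nonneg {X A : Type*} [MeasurableSpace X] {μ : Measure X}
    [CStarAlgebra A] [PartialOrder A] [StarOrderedRing A] {k : ℕ}
    {f : X → CStarMatrix (Fin k) (Fin k) A} (hf : ∀ i j, Integrable (fun x => f x i j) μ)
    (h : ∀ x, 0 ≤ f x) :
    0 ≤ (CStarMatrix.ofMatrix fun i j => ∫ x, f x i j ∂μ : CStarMatrix (Fin k) (Fin k) A) := by
  -- The product topology and the C⋆-norm topology on matrices agree, so this identification is
  -- continuous and commutes with the integral. The entrywise integral thus becomes an integral in a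
  -- C⋆-algebra.
  let L : (Fin k → Fin k → A) →L[ℂ] CStarMatrix (Fin k) (Fin k) A :=
    ⟨(CStarMatrix.ofMatrixL (m := Fin k) (n := Fin k) (A := A)).toLinearEquiv.toLinearMap,
      continuous_id⟩
  let g : X → (Fin k → Fin k → A) := fun x i j => f x i j
  have hg' : ∀ i, Integrable (fun x => g x i) μ := fun i => Integrable.of_eval fun j => hf i j
  have hg : Integrable g μ := Integrable.of_eval hg'
  have h1 : L (∫ x, g x ∂μ) = CStarMatrix.ofMatrix fun i j => ∫ x, f x i j ∂μ := by
    ext i j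
    change (∫ x, g x ∂μ) i j = ∫ x, f x i j ∂μ
    rw [eval_integral hg', eval_integral (hf i)]
  rw [← h1, ← L.integral_comp_comm hg]
  exact integral_cstarAlgebra_nonneg fun x => h x

theorem isUnitalCompletelyPositive_of_linear {A B : Type*} [CStarAlgebra A] [CStarAlgebra B]
    [PartialOrder A] [PartialOrder B] [StarOrderedRing A] [StarOrderedRing B] (φ : A →ₗ[ℂ] B)
    (h : ∀ (k : ℕ) (M : CStarMatrix (Fin k) (Fin k) A), 0 ≤ M → 0 ≤ M.map φ) (h1 : φ 1 = 1) :
    IsUnitalCompletelyPositive φ :=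
  ⟨{ φ with map_cstarMatrix_nonneg' := h }, fun _ => rfl, h1⟩

theorem IsUnitalCompletelyPositive.map_nonneg {A B : Type*} [CStarAlgebra A] [CStarAlgebra B]
    [PartialOrder A] [PartialOrder B] [StarOrderedRing A] [StarOrderedRing B] {φ : A → B}
    (h : IsUnitalCompletelyPositive φ) {k : ℕ} {M : CStarMatrix (Fin k) (Fin k) A}
    (hM : 0 ≤ M) : 0 ≤ M.map φ := by
  obtain ⟨Φ, hΦ, -⟩ := h
  have : M.map φ = M.map Φ := by
    ext i j
    exact (hΦ _).symm
  rw [this]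
  exact Φ.map_cstarMatrix_nonneg' k M hM

variable {X : Type*} [MeasurableSpace X]
  {H : Type*} [NormedAddCommGroup H] [InnerProductSpace ℂ H] [CompleteSpace H]
  [FiniteDimensional ℂ H]

/-- The integral of a positive matrix of integrable functions is positive. -/
theorem POVM.cstarMatrix_integral_nonneg (ν : POVM X H) {k : ℕ}
    {F : X → CStarMatrix (Fin k) (Fin k) (H →L[ℂ] H)}
    (hF : ∀ i j, ν.IsIntegrable fun x => F x i j) (h : ∀ x, 0 ≤ F x) :
    0 ≤ (CStarMatrix.ofMatrix fun i j => ν.integral fun x => F x i j :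
      CStarMatrix (Fin k) (Fin k) (H →L[ℂ] H)) := by
  have h1 := integral_cstarMatrix_nonneg (μ := ν.traceMeasure)
    (f := fun x => (F x).map fun z => CFC.sqrt (ν.rnDeriv x) * z * CFC.sqrt (ν.rnDeriv x))
    (fun i j => (ν.isIntegrable_iff.mp (hF i j)).2)
    (fun x => cstarMatrix_map_conj_nonneg (h x) (ν.sqrt_rnDeriv_isSelfAdjoint x))
  convert h1 using 1
  ext1 i j
  exact ν.integral_eq (hF i j)

/-- The map `z ↦ ∫ z dν` as a continuous linear map. -/
def POVM.channel (ν : POVM X H) : (H →L[ℂ] H) →L[ℂ] (H →L[ℂ] H) :=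
  LinearMap.toContinuousLinearMap
    { toFun := fun z => ν.integral fun _ => z
      map_add' := fun a b => ν.integral_add (ν.isIntegrable_const a) (ν.isIntegrable_const b)
      map_smul' := fun c a => ν.integral_smul (ν.isIntegrable_const a) c }

theorem POVM.channel_apply (ν : POVM X H) (z : H →L[ℂ] H) :
    ν.channel z = ν.integral fun _ => z := rfl

theorem POVM.IsProbability.isUnitalQuantumChannel {ν : POVM X H} (hν : ν.IsProbability) :
    IsUnitalQuantumChannel ν.channel :=
  ⟨isUnitalCompletelyPositive_of_linear ν.channel.toLinearMap
    (fun _ M hM => ν.cstarMatrix_integral_nonneg (F := fun _ => M)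
      (fun i j => ν.isIntegrable_const (M i j)) fun _ => hM) hν.integral_one,
    hν.opTrace_integral_const⟩

theorem POVM.IsProbability.isState_integral_const {ν : POVM X H} (hν : ν.IsProbability)
    {ρ : H →L[ℂ] H} (hρ : IsState ρ) : IsState (ν.integral fun _ => ρ) :=
  ⟨ν.integral_nonneg (ν.isIntegrable_const ρ) (.of_forall fun _ => hρ.1),
    (hν.opTrace_integral_const ρ).trans hρ.2⟩

end CompletePositivity

/-! ### Integration of continuous operator-valued functions -/

section ContinuousFunctions

variable {X : Type*} [TopologicalSpace X] [CompactSpace X] [MeasurableSpace X] [BorelSpace X]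
  {H : Type*} [NormedAddCommGroup H] [InnerProductSpace ℂ H] [CompleteSpace H]
  [FiniteDimensional ℂ H]

theorem POVM.isIntegrable_continuousMap (ν : POVM X H) (f : C(X, H →L[ℂ] H)) :
    ν.IsIntegrable f :=
  ν.isIntegrable_of_bounded f.continuous.measurable f.norm_coe_le_norm

theorem POVM.IsProbability.isUnitalCompletelyPositive_continuousMap {ν : POVM X H}
    (hν : ν.IsProbability) :
    IsUnitalCompletelyPositive fun f : C(X, H →L[ℂ] H) => ν.integral f := by
  let φ : C(X, H →L[ℂ] H) →ₗ[ℂ] (H →L[ℂ] H) :=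
    { toFun := fun f => ν.integral f
      map_add' := fun f g =>
        ν.integral_add (ν.isIntegrable_continuousMap f) (ν.isIntegrable_continuousMap g)
      map_smul' := fun c f => ν.integral_smul (ν.isIntegrable_continuousMap f) c }
  refine isUnitalCompletelyPositive_of_linear φ (fun k M hM => ?_) hν.integral_one
  refine ν.cstarMatrix_integral_nonneg (F := fun x => M.map fun f => f x)
    (fun i j => ν.isIntegrable_continuousMap (M i j)) fun x => ?_
  -- Evaluation at `x` is a star-homomorphism, hence so is its entrywise extension to matrices,
  -- which therefore preserves positivity.
  let ev : C(X, H →L[ℂ] H) →⋆ₙₐ[ℂ] (H →L[ℂ] H) :=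
    { toFun := fun f => f x
      map_smul' := fun _ _ => rfl
      map_zero' := rfl
      map_add' := fun _ _ => rfl
      map_mul' := fun _ _ => rfl
      map_star' := fun _ => rfl }
  exact map_nonneg (CStarMatrix.mapₙₐ ev) hM

end ContinuousFunctions

/-! ### The mean ergodic theorem in finite dimension -/

section MeanErgodic

variable {V : Type*} [NormedAddCommGroup V] [NormedSpace ℂ V] [FiniteDimensional ℂ V]

/-- In coordinates an operator is the tuple of its values on a basis, and this identification is a
homeomorphism. -/
theorem tendsto_clm_of_tendsto_apply {W : Type*} [NormedAddCommGroup W] [NormedSpace ℂ W]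
    {ι : Type*} {l : Filter ι} {f : ι → V →L[ℂ] W} {g : V →L[ℂ] W}
    (h : ∀ v, Tendsto (fun i => f i v) l (𝓝 (g v))) : Tendsto f l (𝓝 g) := by
  let e : (V →L[ℂ] W) ≃L[ℂ] Fin (Module.finrank ℂ V) → W :=
    ((ContinuousLinearEquiv.ofFinrankEq (Module.finrank_fin_fun ℂ).symm).arrowCongr
      (1 : W ≃L[ℂ] W)).trans (ContinuousLinearEquiv.piRing _)
  rw [e.toHomeomorph.isInducing.tendsto_nhds_iff]
  exact tendsto_pi_nhds.mpr fun i => h _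

/-- The mean ergodic theorem for a power bounded operator on a finite-dimensional space. -/
theorem exists_tendsto_average_pow (T : V →L[ℂ] V) (hT : ∀ v, ∃ C, ∀ n : ℕ, ‖(T ^ n) v‖ ≤ C) :
    ∃ P : V →L[ℂ] V, (∀ v, T (P v) = P v) ∧ (∀ v, T v = v → P v = v) ∧
      Tendsto (fun N : ℕ => (N : ℂ)⁻¹ • ∑ j ∈ Finset.range N, T ^ j) atTop (𝓝 P) := by
  let D : V →ₗ[ℂ] V := (T : V →ₗ[ℂ] V) - 1
  have hD : ∀ v, D v = T v - v := fun v => rfl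
  have hpow : ∀ w, T w = w → ∀ n : ℕ, (T ^ n) w = w := by
    intro w hw n
    induction n with
    | zero => simp
    | succ n ih => rw [pow_succ, mul_apply_eq_comp, hw, ih]
  have hz : Tendsto (fun N : ℕ => ((N : ℝ)⁻¹)) atTop (𝓝 0) :=
    tendsto_inv_atTop_zero.comp tendsto_natCast_atTop_atTop
  have hdiff : ∀ v, Tendsto (fun N : ℕ => (N : ℂ)⁻¹ • ((T ^ N) v - v)) atTop (𝓝 0) := by
    intro v
    obtain ⟨C, hC⟩ := hT v
    have hlim : Tendsto (fun N : ℕ => ((N : ℝ)⁻¹) * (C + ‖v‖)) atTop (𝓝 0) := by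
      simpa using hz.mul_const (C + ‖v‖)
    refine squeeze_zero_norm (fun N => ?_) hlim
    rw [norm_smul, norm_inv, Complex.norm_natCast]
    gcongr
    exact (norm_sub_le _ _).trans (by gcongr; exact hC N)
  have hsum : ∀ v, ∀ N : ℕ, (∑ j ∈ Finset.range N, T ^ j) (T v - v) = (T ^ N) v - v := by
    intro v N
    rw [FunLike.coe_sum, Finset.sum_apply]
    have := Finset.sum_range_sub (fun j => (T ^ j) v) N
    simp only [pow_zero, one_apply_eq_self] at this
    rw [← this]
    refine Finset.sum_congr rfl fun j _ => ?_
    rw [map_sub, pow_succ, mul_apply_eq_comp]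
  have hfix : ∀ w, T w = w → ∀ N : ℕ, N ≠ 0 →
      (N : ℂ)⁻¹ • (∑ j ∈ Finset.range N, T ^ j) w = w := by
    intro w hw N hN
    rw [FunLike.coe_sum, Finset.sum_apply]
    simp only [hpow w hw, Finset.sum_const, Finset.card_range]
    rw [← Nat.cast_smul_eq_nsmul ℂ, inv_smul_smul₀ (Nat.cast_ne_zero.mpr hN)]
  -- If `T z - z` is fixed by `T`, its averages all equal itself, yet they telescope to `N⁻¹ (T^N z
  -- - z)`, which tends to `0`. With rank–nullity, the space is the direct sum of `ker (T - 1)` and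
  -- `range (T - 1)`.
  have hdisj : Disjoint (LinearMap.ker D) (LinearMap.range D) := by
    rw [Submodule.disjoint_def]
    rintro w hw ⟨z, rfl⟩
    have hw' : T (D z) = D z := sub_eq_zero.mp hw
    have hlim := hdiff z
    have : ∀ᶠ N : ℕ in atTop, (N : ℂ)⁻¹ • ((T ^ N) z - z) = D z := by
      filter_upwards [eventually_ne_atTop 0] with N hN
      rw [← hsum z N, ← hD, hfix _ hw' N hN]
    exact (tendsto_nhds_unique (tendsto_const_nhds.congr' (this.mono fun _ h => h.symm)) hlim)
  have hcompl : IsCompl (LinearMap.ker D) (LinearMap.range D) := by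
    refine ⟨hdisj, codisjoint_iff.mpr (Submodule.eq_top_of_disjoint _ _ ?_ hdisj)⟩
    rw [add_comm, LinearMap.finrank_range_add_finrank_ker]
  let P : V →L[ℂ] V :=
    LinearMap.toContinuousLinearMap ((LinearMap.ker D).projection (LinearMap.range D) hcompl)
  have hPker : ∀ v, P v ∈ LinearMap.ker D := Submodule.projection_apply_mem hcompl
  refine ⟨P, fun v => sub_eq_zero.mp (hPker v), fun v hv => ?_, ?_⟩
  · exact Submodule.projection_apply_left hcompl ⟨v, by simp [hD, hv]⟩
  · refine tendsto_clm_of_tendsto_apply fun v => ?_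
    obtain ⟨z, hz'⟩ : v - P v ∈ LinearMap.range D := Submodule.sub_projection_mem hcompl v
    have hv : v = P v + (T z - z) := by rw [← hD, hz']; abel
    have h1 : ∀ᶠ N : ℕ in atTop, P v + (N : ℂ)⁻¹ • ((T ^ N) z - z) =
        ((N : ℂ)⁻¹ • ∑ j ∈ Finset.range N, T ^ j) v := by
      filter_upwards [eventually_ne_atTop 0] with N hN
      conv_rhs => rw [hv]
      rw [FunLike.coe_smul, Pi.smul_apply, map_add, smul_add, hsum,
        hfix _ (sub_eq_zero.mp (hPker v)) N hN]
    simpa using (tendsto_const_nhds.add (hdiff z)).congr' h1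

end MeanErgodic

/-! ### The ergodic limit as a conditional expectation -/

section Ergodic

variable {H : Type*} [NormedAddCommGroup H] [InnerProductSpace ℂ H] [CompleteSpace H]
  [FiniteDimensional ℂ H]

/-- For a state `a`, every power of `T` preserves `0 ≤ a ≤ tr(a) · 1`, which bounds the norm of the
orbit; states span `B(H)`. -/
theorem bounded_orbit_of_positive_unital {T : (H →L[ℂ] H) →L[ℂ] (H →L[ℂ] H)}
    (hpos : ∀ a, 0 ≤ a → 0 ≤ T a) (hone : T 1 = 1) (v : H →L[ℂ] H) :
    ∃ C, ∀ n : ℕ, ‖(T ^ n) v‖ ≤ C := by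
  have hposn : ∀ (n : ℕ) a, 0 ≤ a → 0 ≤ (T ^ n) a := by
    intro n
    induction n with
    | zero => simp
    | succ n ih =>
      intro a ha
      rw [pow_succ, mul_apply_eq_comp]
      exact ih _ (hpos _ ha)
  have honen : ∀ n : ℕ, (T ^ n) 1 = 1 := by
    intro n
    induction n with
    | zero => simp
    | succ n ih => rw [pow_succ, mul_apply_eq_comp, hone, ih]
  refine induction_isState (p := fun v => ∃ C, ∀ n : ℕ, ‖(T ^ n) v‖ ≤ C) ?_ ⟨0, by simp⟩ ?_ ?_ v
  · intro a ha
    have h1 : a ≤ opTrace a • (1 : H →L[ℂ] H) := le_opTrace_smul_one ha.1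
    refine ⟨‖opTrace a • (1 : H →L[ℂ] H)‖, fun n => ?_⟩
    refine CStarAlgebra.norm_le_norm_of_nonneg_of_le (hposn n a ha.1) ?_
    have h2 := hposn n _ (sub_nonneg.mpr h1)
    rwa [map_sub, map_smul, honen, sub_nonneg] at h2
  · rintro a b ⟨C, hC⟩ ⟨C', hC'⟩
    exact ⟨C + C', fun n => by
      rw [map_add]; exact (norm_add_le _ _).trans (add_le_add (hC n) (hC' n))⟩
  · rintro c a ⟨C, hC⟩
    exact ⟨‖c‖ * C, fun n => by
      rw [map_smul, norm_smul]; exact mul_le_mul_of_nonneg_left (hC n) (norm_nonneg _)⟩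

theorem cstarMatrix_map_average_nonneg {A : Type*} [CStarAlgebra A] [PartialOrder A]
    [StarOrderedRing A] {T : A →L[ℂ] A}
    (hT : ∀ (k : ℕ) (M : CStarMatrix (Fin k) (Fin k) A), 0 ≤ M → 0 ≤ M.map T)
    (N k : ℕ) {M : CStarMatrix (Fin k) (Fin k) A} (hM : 0 ≤ M) :
    0 ≤ M.map ((N : ℂ)⁻¹ • ∑ j ∈ Finset.range N, T ^ j) := by
  have hpow : ∀ j : ℕ, 0 ≤ M.map ⇑(T ^ j) := by
    intro j
    induction j with
    | zero => simpa using! hM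
    | succ j ih =>
      have h := hT k _ ih
      rwa [pow_succ']
  have hsum : ∀ n : ℕ, 0 ≤ M.map ⇑(∑ j ∈ Finset.range n, T ^ j) := by
    intro n
    induction n with
    | zero => exact le_of_eq (by ext i j; simp)
    | succ n ih =>
      rw [Finset.sum_range_succ]
      exact add_nonneg ih (hpow n)
  have hN : (0 : ℂ) ≤ (N : ℂ)⁻¹ := by
    rw [show (N : ℂ)⁻¹ = (((N : ℝ)⁻¹ : ℝ) : ℂ) by push_cast; rfl]
    exact Complex.zero_le_real.mpr (by positivity)
  exact smul_nonneg hN (hsum N)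

theorem tendsto_cstarMatrix {ι A : Type*} [CStarAlgebra A] {l : Filter ι} {k : ℕ}
    {f : ι → CStarMatrix (Fin k) (Fin k) A} {M : CStarMatrix (Fin k) (Fin k) A}
    (h : ∀ i j, Tendsto (fun n => f n i j) l (𝓝 (M i j))) : Tendsto f l (𝓝 M) := by
  have h' : Tendsto (fun n => (CStarMatrix.ofMatrixL (A := A)).symm (f n)) l
      (𝓝 ((CStarMatrix.ofMatrixL (A := A)).symm M)) :=
    tendsto_pi_nhds.mpr fun i => tendsto_pi_nhds.mpr fun j => h i j
  exact ((CStarMatrix.ofMatrixL (A := A)).continuous.tendsto _).comp h'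

variable {X : Type*} [MeasurableSpace X]

/-- The limit takes values in the fixed points and fixes each of them, which gives both idempotence
and the range. Matrix positivity is a closed condition satisfied by all averages. -/
theorem POVM.IsProbability.exists_ergodic {ν : POVM X H} (hν : ν.IsProbability) :
    ∃ P : (H →L[ℂ] H) →L[ℂ] (H →L[ℂ] H), IsConditionalExpectation P ∧
      (∀ z, opTrace (P z) = opTrace z) ∧ Set.range P = ν.fixedPoints ∧
      Tendsto (fun N : ℕ => (N : ℂ)⁻¹ • (1 + ∑ j ∈ Finset.Ico 1 N, ν.channel ^ j)) atTop
        (𝓝 P) := by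
  obtain ⟨hUCP, htr⟩ := hν.isUnitalQuantumChannel
  obtain ⟨P, hP1, hP2, hP3⟩ := exists_tendsto_average_pow ν.channel
    (bounded_orbit_of_positive_unital (fun a ha =>
      ν.integral_nonneg (ν.isIntegrable_const a) (.of_forall fun _ => ha)) hν.integral_one)
  have hlim : ∀ z, Tendsto
      (fun N : ℕ => ((N : ℂ)⁻¹ • ∑ j ∈ Finset.range N, ν.channel ^ j) z) atTop (𝓝 (P z)) :=
    fun z => ((ContinuousLinearMap.apply ℂ _ z).continuous.tendsto P).comp hP3
  refine ⟨P, ⟨isUnitalCompletelyPositive_of_linear P.toLinearMap (fun k M hM => ?_)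
    (hP2 1 hν.integral_one), fun z => hP2 _ (hP1 z)⟩, fun z => ?_, ?_, ?_⟩
  · have hcont : Tendsto
        (fun N : ℕ => M.map ((N : ℂ)⁻¹ • ∑ j ∈ Finset.range N, ν.channel ^ j)) atTop
        (𝓝 (M.map P)) :=
      tendsto_cstarMatrix fun i j => hlim (M i j)
    exact ge_of_tendsto' hcont fun N =>
      cstarMatrix_map_average_nonneg (fun _ _ h => hUCP.map_nonneg h) N k hM
  · have htrpow : ∀ (j : ℕ), opTrace ((ν.channel ^ j) z) = opTrace z := by
      intro j
      induction j with
      | zero => simp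
      | succ j ih => rw [pow_succ', mul_apply_eq_comp, htr, ih]
    have h1 := (continuous_opTrace.tendsto _).comp (hlim z)
    refine tendsto_nhds_unique h1 (tendsto_const_nhds.congr' ?_)
    filter_upwards [eventually_ne_atTop 0] with N hN
    rw [Function.comp_apply, FunLike.coe_smul, Pi.smul_apply, FunLike.coe_sum, Finset.sum_apply,
      map_smul, map_sum]
    simp only [htrpow, Finset.sum_const, Finset.card_range]
    rw [← Nat.cast_smul_eq_nsmul ℂ, inv_smul_smul₀ (Nat.cast_ne_zero.mpr hN)]
  · ext z
    exact ⟨by rintro ⟨w, rfl⟩; exact hP1 w, fun hz => ⟨z, hP2 z hz⟩⟩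
  · refine hP3.congr' ?_
    filter_upwards [eventually_gt_atTop 0] with N hN
    rw [Finset.range_eq_Ico, Finset.sum_eq_sum_Ico_succ_bot hN, pow_zero]

end Ergodic

/-! ### Operator convexity and Jensen's inequality for finite sums -/

section FunctionalCalculus

open ContinuousLinearMap

variable {K : Type*} [NormedAddCommGroup K] [InnerProductSpace ℂ K] [CompleteSpace K]
  [FiniteDimensional ℂ K]
  {L : Type*} [NormedAddCommGroup L] [InnerProductSpace ℂ L] [CompleteSpace L]
  [FiniteDimensional ℂ L]

theorem finite_spectrum_real (a : K →L[ℂ] K) : (spectrum ℝ a).Finite := by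
  rw [← spectrum.preimage_algebraMap ℂ]
  refine Set.Finite.preimage (Complex.ofReal_injective.injOn) ?_
  have h : spectrum ℂ a = spectrum ℂ (a : Module.End ℂ K) :=
    (AlgEquiv.spectrum_eq (Module.End.toContinuousLinearMap K).symm a).symm
  rw [h]
  exact Module.End.finite_spectrum _

/-- The functional calculus respects intertwining relations. -/
theorem cfc_comp_eq_comp_cfc {A : K →L[ℂ] K} {B : L →L[ℂ] L} (hA : IsSelfAdjoint A)
    (hB : IsSelfAdjoint B) {W : K →L[ℂ] L} (hW : B ∘L W = W ∘L A) (f : ℝ → ℝ) :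
    cfc f B ∘L W = W ∘L cfc f A := by
  classical
  -- Interpolating `f` on both finite spectra at once gives a single polynomial `p` with `f(A) =
  -- p(A)` and `f(B) = p(B)`; no continuity of `f` is involved.
  let t : Finset ℝ := ((finite_spectrum_real A).union (finite_spectrum_real B)).toFinset
  let p : Polynomial ℝ := Lagrange.interpolate t id f
  have hp : ∀ x ∈ t, f x = p.eval x := fun x hx =>
    (Lagrange.eval_interpolate_at_node f (v := id) (Function.injective_id.injOn) hx).symm
  have h1 : cfc f A = Polynomial.aeval A p := by
    rw [← cfc_polynomial p A]
    exact cfc_congr fun x hx => hp x (by simp [t, hx])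
  have h2 : cfc f B = Polynomial.aeval B p := by
    rw [← cfc_polynomial p B]
    exact cfc_congr fun x hx => hp x (by simp [t, hx])
  rw [h1, h2]
  induction p using Polynomial.induction_on' with
  | add p q hp hq => rw [map_add, map_add, add_comp, comp_add, hp, hq]
  | monomial n c =>
    have hpow : (B ^ n) ∘L W = W ∘L (A ^ n) := by
      induction n with
      | zero => rfl
      | succ n ih =>
        rw [pow_succ, pow_succ', mul_def, comp_assoc, hW, ← comp_assoc, ih, comp_assoc, mul_def]
        rw [← mul_def, ← mul_def, ← pow_succ, pow_succ']
    rw [Polynomial.aeval_monomial, Polynomial.aeval_monomial, ← Algebra.smul_def,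
      ← Algebra.smul_def, smul_comp, hpow]
    ext v
    simp

/-- Operator convexity holds for operators on every finite-dimensional Hilbert space. -/
theorem OperatorConvexOn.operator {J : Set ℝ} {ϑ : ℝ → ℝ} (h : OperatorConvexOn J ϑ)
    {A B : K →L[ℂ] K} (hA : IsSelfAdjoint A) (hB : IsSelfAdjoint B) (hAJ : spectrum ℝ A ⊆ J)
    (hBJ : spectrum ℝ B ⊆ J) {t : ℝ} (h0 : 0 ≤ t) (h1 : t ≤ 1) :
    cfc ϑ (t • A + (1 - t) • B) ≤ t • cfc ϑ A + (1 - t) • cfc ϑ B := by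
  let e := (stdOrthonormalBasis ℂ K).repr
  -- Orthonormal coordinates carry operators on `K` to the Euclidean spaces in which operator
  -- convexity is phrased.
  let Φ := e.conjStarAlgEquiv
  have hsa : ∀ a : K →L[ℂ] K, IsSelfAdjoint a → IsSelfAdjoint (Φ a) := fun a ha => ha.map Φ
  have hsp : ∀ a : K →L[ℂ] K, spectrum ℝ (Φ a) = spectrum ℝ a := by
    intro a
    calc spectrum ℝ (Φ a) = algebraMap ℝ ℂ ⁻¹' spectrum ℂ (Φ a) :=
          (spectrum.preimage_algebraMap ℂ).symm
      _ = algebraMap ℝ ℂ ⁻¹' spectrum ℂ a := by rw [AlgEquiv.spectrum_eq Φ a]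
      _ = spectrum ℝ a := spectrum.preimage_algebraMap ℂ
  have hcfc : ∀ a : K →L[ℂ] K, IsSelfAdjoint a → cfc ϑ (Φ a) = Φ (cfc ϑ a) := by
    intro a ha
    have hW : Φ a ∘L (e : K →L[ℂ] _) = (e : K →L[ℂ] _) ∘L a := by
      ext1 v
      simp [Φ]
    have := cfc_comp_eq_comp_cfc ha (hsa a ha) hW ϑ
    ext1 v
    have h2 := congrArg (fun T => T (e.symm v)) this
    simpa [Φ] using h2
  have hreal : ∀ (r : ℝ) (a : K →L[ℂ] K), Φ (r • a) = r • Φ a := by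
    intro r a
    rw [← Complex.coe_smul, map_smul, Complex.coe_smul]
  have key := h _ (Φ A) (Φ B) (hsa A hA) (hsa B hB) (by rwa [hsp]) (by rwa [hsp]) t h0 h1
  have hC : IsSelfAdjoint (t • A + (1 - t) • B) :=
    ((IsSelfAdjoint.all t).smul hA).add ((IsSelfAdjoint.all (1 - t)).smul hB)
  rw [← hreal, ← hreal, ← map_add, hcfc _ hC, hcfc A hA, hcfc B hB, ← hreal, ← hreal,
    ← map_add] at key
  exact (map_le_map_iff Φ).mp key

theorem adjoint_comp_le_adjoint_comp {A B : L →L[ℂ] L} (h : A ≤ B) (V : K →L[ℂ] L) :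
    adjoint V ∘L A ∘L V ≤ adjoint V ∘L B ∘L V := by
  have := ((ContinuousLinearMap.le_def A B).mp h).adjoint_conj V
  rw [sub_comp, comp_sub] at this
  exact (ContinuousLinearMap.le_def _ _).mpr this

/-- Compressing by an isometry decreases the value of an operator convex function. -/
theorem OperatorConvexOn.compression {J : Set ℝ} {ϑ : ℝ → ℝ} (h : OperatorConvexOn J ϑ)
    {A : L →L[ℂ] L} (hA : IsSelfAdjoint A) (hAJ : spectrum ℝ A ⊆ J) {V : K →L[ℂ] L}
    (hV : adjoint V ∘L V = 1) :
    cfc ϑ (adjoint V ∘L A ∘L V) ≤ adjoint V ∘L cfc ϑ A ∘L V := by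
  -- The reflection in the range of `V`: a self-adjoint unitary with `U V = V`.
  let U : L →L[ℂ] L := (2 : ℂ) • (V ∘L adjoint V) - 1
  have hVV : ∀ k, adjoint V (V k) = k := fun k => congrArg (fun T => T k) hV
  have hUV : ∀ k, U (V k) = V k := by
    intro k
    simp only [U, sub_apply, smul_apply, comp_apply, hVV, one_apply_eq_self]
    module
  have hVU : ∀ l, adjoint V (U l) = adjoint V l := by
    intro l
    simp only [U, sub_apply, smul_apply, comp_apply, hVV, one_apply_eq_self, map_sub, map_smul]
    module
  have hUU : U * U = 1 := by
    ext1 l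
    change U (U l) = l
    conv_lhs => enter [2]; simp only [U, sub_apply, smul_apply, comp_apply, one_apply_eq_self]
    rw [map_sub, map_smul, hUV]
    simp only [U, sub_apply, smul_apply, comp_apply, one_apply_eq_self]
    module
  have hUsa : IsSelfAdjoint U := by
    have h1 : IsSelfAdjoint (V ∘L adjoint V) := by
      rw [isSelfAdjoint_iff', adjoint_comp, adjoint_adjoint]
    have h2 : IsSelfAdjoint (2 : ℂ) := by simp
    exact (h2.smul h1).sub (IsSelfAdjoint.one _)
  have hUAU : IsSelfAdjoint (U * A * U) := by
    have := hA.conjugate U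
    rwa [hUsa.star_eq] at this
  have hspec : spectrum ℝ (U * A * U) = spectrum ℝ A := by
    let u : (L →L[ℂ] L)ˣ := ⟨U, U, hUU, hUU⟩
    exact spectrum.units_conjugate (u := u)
  have hcfcU : cfc ϑ (U * A * U) = U * cfc ϑ A * U := by
    have hW : (U * A * U) ∘L U = U ∘L A := by
      rw [← mul_def, ← mul_def, mul_assoc (U * A), hUU, mul_one]
    have := cfc_comp_eq_comp_cfc hA hUAU hW ϑ
    rw [← mul_def, ← mul_def] at this
    rw [← this, mul_assoc (cfc ϑ (U * A * U)), hUU, mul_one]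
  -- Averaging removes the off-diagonal blocks of `A`, so the range of `V` is invariant under `B`,
  -- which acts there as the compression `V*AV`. Hence `V*ϑ(B)V = ϑ(V*AV)`, while convexity bounds
  -- `ϑ(B)`.
  let B : L →L[ℂ] L := (1 / 2 : ℝ) • A + (1 - 1 / 2 : ℝ) • (U * A * U)
  have hBsa : IsSelfAdjoint B :=
    ((IsSelfAdjoint.all _).smul hA).add ((IsSelfAdjoint.all _).smul hUAU)
  have hC : IsSelfAdjoint (adjoint V ∘L A ∘L V) := hA.adjoint_conj V
  have hBV : B ∘L V = V ∘L (adjoint V ∘L A ∘L V) := by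
    ext1 k
    simp only [B, comp_apply, add_apply, smul_apply, mul_apply_eq_comp, hUV]
    simp only [U, sub_apply, smul_apply, comp_apply, one_apply_eq_self]
    module
  have h1 := h.operator hA hUAU hAJ (hspec.trans_subset hAJ) (t := 1 / 2) (by norm_num)
    (by norm_num)
  have h2 := adjoint_comp_le_adjoint_comp h1 V
  have h3 : adjoint V ∘L cfc ϑ B ∘L V = cfc ϑ (adjoint V ∘L A ∘L V) := by
    rw [cfc_comp_eq_comp_cfc hC hBsa hBV, ← comp_assoc, hV]
    rfl
  rw [← h3]
  refine h2.trans_eq ?_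
  rw [hcfcU]
  ext1 k
  simp only [comp_apply, add_apply, smul_apply, mul_apply_eq_comp, hUV, map_add]
  have hr : ∀ (r : ℝ) l, adjoint V (r • l) = r • adjoint V l := fun r l => by
    rw [← Complex.coe_smul, map_smul, Complex.coe_smul]
  rw [hr, hr, hVU]
  module

theorem spectrum_subset_Icc_iff {a : K →L[ℂ] K} (ha : IsSelfAdjoint a) {α β : ℝ} :
    spectrum ℝ a ⊆ Set.Icc α β ↔
      algebraMap ℝ (K →L[ℂ] K) α ≤ a ∧ a ≤ algebraMap ℝ (K →L[ℂ] K) β := by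
  rw [algebraMap_le_iff_le_spectrum, le_algebraMap_iff_spectrum_le]
  exact ⟨fun h => ⟨fun x hx => (h hx).1, fun x hx => (h hx).2⟩,
    fun h x hx => ⟨h.1 x hx, h.2 x hx⟩⟩

/-- **Jensen's operator inequality** for finite operator convex combinations. -/
theorem OperatorConvexOn.sum_le {J : Set ℝ} {ϑ : ℝ → ℝ} (h : OperatorConvexOn J ϑ)
    {α β : ℝ} (hJ : Set.Icc α β ⊆ J) {ι : Type*} [Fintype ι] {a b : ι → (K →L[ℂ] K)}
    (ha : ∀ i, IsSelfAdjoint (a i)) (hab : ∀ i, spectrum ℝ (a i) ⊆ Set.Icc α β)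
    (hb : ∑ i, star (b i) * b i = 1) :
    cfc ϑ (∑ i, star (b i) * a i * b i) ≤ ∑ i, star (b i) * cfc ϑ (a i) * b i := by
  -- On the direct sum of copies of `K`, `V` stacks the `b i` into a column, an isometry because `∑
  -- b_i* b_i = 1`, and `A` is block-diagonal with blocks `a i`.
  let E := PiLp 2 fun _ : ι => K
  let V : K →L[ℂ] E :=
    (PiLp.continuousLinearEquiv 2 ℂ fun _ : ι => K).symm.toContinuousLinearMap ∘L
      ContinuousLinearMap.pi b
  let A : E →L[ℂ] E :=
    (PiLp.continuousLinearEquiv 2 ℂ fun _ : ι => K).symm.toContinuousLinearMap ∘L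
      ContinuousLinearMap.pi fun i => a i ∘L PiLp.proj 2 (fun _ : ι => K) i
  have hVi : ∀ k i, V k i = b i k := fun k i => rfl
  have hAi : ∀ y i, A y i = a i (y i) := fun y i => rfl
  have hcomp : ∀ (T : E →L[ℂ] E) (t : ι → (K →L[ℂ] K)), (∀ y i, T y i = t i (y i)) →
      adjoint V ∘L T ∘L V = ∑ i, star (b i) * t i * b i := by
    intro T t ht
    ext1 k
    refine ext_inner_left ℂ fun w => ?_
    change inner ℂ w (adjoint V (T (V k))) = _
    rw [adjoint_inner_right, PiLp.inner_apply, sum_apply, inner_sum]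
    refine Finset.sum_congr rfl fun i _ => ?_
    rw [ht, hVi, hVi, mul_apply_eq_comp, mul_apply_eq_comp, star_eq_adjoint,
      adjoint_inner_right]
  have hAsa : IsSelfAdjoint A := by
    rw [isSelfAdjoint_iff_isSymmetric]
    intro x y
    change inner ℂ (A x) y = inner ℂ x (A y)
    rw [PiLp.inner_apply, PiLp.inner_apply]
    refine Finset.sum_congr rfl fun i _ => ?_
    rw [hAi, hAi]
    exact (isSelfAdjoint_iff_isSymmetric.mp (ha i)) _ _
  have hnonneg : ∀ (T : E →L[ℂ] E) (t : ι → (K →L[ℂ] K)), (∀ y i, T y i = t i (y i)) →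
      (∀ i, 0 ≤ t i) → 0 ≤ T := by
    intro T t ht h0
    rw [nonneg_iff_forall_inner]
    intro y
    rw [PiLp.inner_apply]
    refine Finset.sum_nonneg fun i _ => ?_
    rw [ht]
    exact nonneg_iff_forall_inner.mp (h0 i) _
  have hAspec : spectrum ℝ A ⊆ Set.Icc α β := by
    rw [spectrum_subset_Icc_iff hAsa]
    have hab' := fun i => (spectrum_subset_Icc_iff (ha i)).mp (hab i)
    constructor
    · rw [← sub_nonneg]
      exact hnonneg _ (fun i => a i - algebraMap ℝ _ α) (fun y i => rfl)
        fun i => sub_nonneg.mpr (hab' i).1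
    · rw [← sub_nonneg]
      exact hnonneg _ (fun i => algebraMap ℝ _ β - a i) (fun y i => rfl)
        fun i => sub_nonneg.mpr (hab' i).2
  have hcfcA : ∀ y i, cfc ϑ A y i = cfc ϑ (a i) (y i) := by
    intro y i
    have hW : a i ∘L PiLp.proj 2 (fun _ : ι => K) i = PiLp.proj 2 (fun _ : ι => K) i ∘L A := rfl
    exact (congrArg (fun T => T y) (cfc_comp_eq_comp_cfc hAsa (ha i) hW ϑ)).symm
  have hV : adjoint V ∘L V = 1 := by
    have := hcomp 1 (fun _ => 1) fun y i => rfl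
    simp only [mul_one, hb] at this
    exact this
  have := h.compression hAsa (hAspec.trans hJ) hV
  rwa [hcomp A a hAi, hcomp _ _ hcfcA] at this

/-- Scalars are `1 × 1` matrices. Ordinary convexity makes `ϑ` continuous on an open `J`, so that
`cfc ϑ` is continuous on the compact set below. -/
theorem OperatorConvexOn.convexOn {J : Set ℝ} {ϑ : ℝ → ℝ} (h : OperatorConvexOn J ϑ)
    (hJ : J.OrdConnected) : ConvexOn ℝ J ϑ := by
  refine ⟨hJ.convex, fun x hx y hy s t hs ht hst => ?_⟩
  obtain rfl : t = 1 - s := by linarith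
  let M := EuclideanSpace ℂ (Fin 1) →L[ℂ] EuclideanSpace ℂ (Fin 1)
  have hsp : ∀ r : ℝ, spectrum ℝ (algebraMap ℝ M r) = {r} := fun r => spectrum.scalar_eq r
  have hsa : ∀ r : ℝ, IsSelfAdjoint (algebraMap ℝ M r) := fun r =>
    (IsSelfAdjoint.all r).algebraMap M
  have key := h 1 (algebraMap ℝ M x) (algebraMap ℝ M y) (hsa x) (hsa y)
    (by rw [hsp]; simpa using hx) (by rw [hsp]; simpa using hy) s hs (by linarith)
  have e : ∀ u v : ℝ, s • algebraMap ℝ M u + (1 - s) • algebraMap ℝ M v =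
      algebraMap ℝ M (s * u + (1 - s) * v) := by
    intro u v
    simp only [Algebra.algebraMap_eq_smul_one, smul_smul, add_smul]
  rw [cfc_algebraMap, cfc_algebraMap, e, e, cfc_algebraMap,
    le_algebraMap_iff_spectrum_le, hsp] at key
  simpa using key _ rfl

theorem isCompact_setOf_spectrum_subset_Icc (α β : ℝ) :
    IsCompact {a : K →L[ℂ] K | IsSelfAdjoint a ∧ spectrum ℝ a ⊆ Set.Icc α β} := by
  have : ProperSpace (K →L[ℂ] K) := FiniteDimensional.proper ℂ _
  have e : {a : K →L[ℂ] K | IsSelfAdjoint a ∧ spectrum ℝ a ⊆ Set.Icc α β} =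
      Set.Icc (algebraMap ℝ _ α) (algebraMap ℝ _ β) := by
    ext a
    constructor
    · rintro ⟨h1, h2⟩
      exact (spectrum_subset_Icc_iff h1).mp h2
    · intro h
      have hsa : IsSelfAdjoint a := by
        have := (sub_nonneg.mpr h.1).isSelfAdjoint.add ((IsSelfAdjoint.all α).algebraMap (K →L[ℂ] K))
        simpa using this
      exact ⟨hsa, (spectrum_subset_Icc_iff hsa).mpr h⟩
  rw [e]
  refine Metric.isCompact_of_isClosed_isBounded isClosed_Icc ?_
  refine (Metric.isBounded_iff_subset_closedBall (algebraMap ℝ _ α)).mpr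
    ⟨‖algebraMap ℝ (K →L[ℂ] K) β - algebraMap ℝ (K →L[ℂ] K) α‖, fun a ha => ?_⟩
  rw [mem_closedBall_iff_norm]
  exact CStarAlgebra.norm_le_norm_of_nonneg_of_le (sub_nonneg.mpr ha.1)
    (sub_le_sub_right ha.2 _)

end FunctionalCalculus

/-! ### Compactness of convex hulls -/

section ConvexHull

/-- The convex hull of a compact set in a finite-dimensional space is compact. -/
theorem isCompact_convexHull_of_finiteDimensional {E : Type*} [NormedAddCommGroup E]
    [NormedSpace ℝ E] [FiniteDimensional ℝ E] {s : Set E} (hs : IsCompact s) :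
    IsCompact (convexHull ℝ s) := by
  rcases s.eq_empty_or_nonempty with rfl | ⟨x₀, hx₀⟩
  · simp
  -- Carathéodory: `dim E + 1` points suffice, so the hull is a continuous image of simplex × `s^n`.
  -- Shorter combinations are padded with weight `0` at `x₀`.
  let n := Module.finrank ℝ E + 1
  let F : (Fin n → ℝ) × (Fin n → E) → E := fun p => ∑ i, p.1 i • p.2 i
  have hF : Continuous F := by fun_prop
  have hc : IsCompact (stdSimplex ℝ (Fin n) ×ˢ Set.pi Set.univ fun _ : Fin n => s) :=
    (isCompact_stdSimplex ℝ (Fin n)).prod (isCompact_univ_pi fun _ => hs)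
  convert hc.image hF
  ext x
  constructor
  · intro hx
    obtain ⟨ι, _, z, w, hz, haff, hw, hw1, rfl⟩ := eq_pos_convex_span_of_mem_convexHull hx
    have hcard : Fintype.card ι ≤ Fintype.card (Fin n) := by
      rw [Fintype.card_fin]
      exact haff.card_le_finrank_succ.trans (Nat.succ_le_succ (Submodule.finrank_le _))
    obtain ⟨f⟩ := Function.Embedding.nonempty_of_card_le hcard
    let w' : Fin n → ℝ := Function.extend f w 0
    let z' : Fin n → E := Function.extend f z fun _ => x₀
    have hw' : ∀ i, w' (f i) = w i := fun i => f.injective.extend_apply _ _ _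
    have hz' : ∀ i, z' (f i) = z i := fun i => f.injective.extend_apply _ _ _
    have hout : ∀ j, j ∉ Set.range f → w' j = 0 := fun j hj =>
      Function.extend_apply' _ _ _ hj
    refine ⟨(w', z'), ⟨⟨fun j => ?_, ?_⟩, fun j _ => ?_⟩, ?_⟩
    · change 0 ≤ w' j
      by_cases hj : j ∈ Set.range f
      · obtain ⟨i, rfl⟩ := hj
        rw [hw']
        exact (hw i).le
      · rw [hout j hj]
    · rw [← hw1]
      exact (Fintype.sum_of_injective f f.injective w w' (fun j hj => hout j hj)
        fun i => (hw' i).symm).symm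
    · by_cases hj : j ∈ Set.range f
      · obtain ⟨i, rfl⟩ := hj
        simp only [hz']
        exact hz ⟨i, rfl⟩
      · change Function.extend f z (fun _ => x₀) j ∈ s
        rw [Function.extend_apply' _ _ _ hj]
        exact hx₀
    · exact (Fintype.sum_of_injective f f.injective (fun i => w i • z i)
        (fun j => w' j • z' j) (fun j hj => by simp [hout j hj])
        fun i => by simp [hw', hz']).symm
  · rintro ⟨⟨w, z⟩, ⟨⟨hw, hw1⟩, hz⟩, rfl⟩
    exact (convex_convexHull ℝ s).sum_mem (fun i _ => hw i) hw1
      fun i _ => subset_convexHull ℝ s (hz i trivial)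

end ConvexHull

/-! ### Jensen's inequality for the quantum expectation -/

section Jensen

variable {X : Type*} [MeasurableSpace X]
  {H : Type*} [NormedAddCommGroup H] [InnerProductSpace ℂ H] [CompleteSpace H]
  [FiniteDimensional ℂ H]

theorem POVM.isIntegrable_of_mem_compact (ν : POVM X H) {ψ : X → (H →L[ℂ] H)}
    (hψ : Measurable ψ) {S : Set (H →L[ℂ] H)} (hS : IsCompact S) (hψS : ∀ x, ψ x ∈ S)
    {g : (H →L[ℂ] H) → (H →L[ℂ] H)} (hg : ContinuousOn g S) :
    ν.IsIntegrable fun x => g (ψ x) := by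
  classical
  obtain ⟨C, hC⟩ := (hS.image_of_continuousOn hg).isBounded.exists_norm_le
  refine ν.isIntegrable_of_bounded ?_ (C := C) fun x => hC _ ⟨_, hψS x, rfl⟩
  have hm : Measurable (S.piecewise g fun _ => 0) :=
    hg.measurable_piecewise continuousOn_const hS.measurableSet
  have e : (fun x => g (ψ x)) = fun x => S.piecewise g (fun _ => 0) (ψ x) :=
    funext fun x => (Set.piecewise_eq_of_mem S _ _ (hψS x)).symm
  rw [e]
  exact hm.comp hψ

/-- The spectral condition amounts to `α · 1 ≤ ψ ≤ β · 1`, which integrates because real scalars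
have themselves as expectation. -/
theorem POVM.IsProbability.spectrum_integral_subset {ν : POVM X H} (hν : ν.IsProbability)
    {α β : ℝ} {ψ : X → (H →L[ℂ] H)} (hψ : ν.IsIntegrable ψ)
    (hsp : ∀ x, IsSelfAdjoint (ψ x) ∧ spectrum ℝ (ψ x) ⊆ Set.Icc α β) :
    IsSelfAdjoint (ν.integral ψ) ∧ spectrum ℝ (ν.integral ψ) ⊆ Set.Icc α β := by
  have hbd := fun x => (spectrum_subset_Icc_iff (hsp x).1).mp (hsp x).2
  have hconst : ∀ r : ℝ, (ν.integral fun _ => algebraMap ℝ (H →L[ℂ] H) r) =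
      algebraMap ℝ (H →L[ℂ] H) r := by
    intro r
    have := ν.integral_smul (ν.isIntegrable_const 1) (r : ℂ)
    rwa [hν.integral_one, Complex.coe_smul, ← Algebra.algebraMap_eq_smul_one] at this
  have hlow : algebraMap ℝ (H →L[ℂ] H) α ≤ ν.integral ψ := by
    have hd : ν.IsIntegrable fun x => ψ x + algebraMap ℝ (H →L[ℂ] H) (-α) :=
      hψ.add (ν.isIntegrable_const _)
    have h1 := ν.integral_nonneg hd (.of_forall fun x => by
      rw [map_neg, ← sub_eq_add_neg]
      exact sub_nonneg.mpr (hbd x).1)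
    rw [ν.integral_add hψ (ν.isIntegrable_const _), hconst, map_neg, ← sub_eq_add_neg] at h1
    exact sub_nonneg.mp h1
  have hneg : ν.IsIntegrable (fun x => (-1 : ℂ) • ψ x) ∧
      ν.integral (fun x => (-1 : ℂ) • ψ x) = - ν.integral ψ := by
    have hc : ∀ᵐ x ∂ν.traceMeasure, Commute (-1 : H →L[ℂ] H) (ν.rnDeriv x) :=
      .of_forall fun x => (Commute.one_left _).neg_left
    have h0 : ∀ᵐ x ∂ν.traceMeasure, Commute (0 : H →L[ℂ] H) (ν.rnDeriv x) :=
      .of_forall fun x => Commute.zero_left _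
    simpa using ν.integral_generalised_linear hψ hψ hc h0
  have hup : ν.integral ψ ≤ algebraMap ℝ (H →L[ℂ] H) β := by
    have hd : ν.IsIntegrable fun x => (-1 : ℂ) • ψ x + algebraMap ℝ (H →L[ℂ] H) β :=
      hneg.1.add (ν.isIntegrable_const _)
    have h1 := ν.integral_nonneg hd (.of_forall fun x => by
      rw [neg_smul, one_smul, neg_add_eq_sub]
      exact sub_nonneg.mpr (hbd x).2)
    rw [ν.integral_add hneg.1 (ν.isIntegrable_const _), hconst, hneg.2, neg_add_eq_sub] at h1
    exact sub_nonneg.mp h1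
  have hsa : IsSelfAdjoint (ν.integral ψ) := by
    have := (sub_nonneg.mpr hlow).isSelfAdjoint.add
      ((IsSelfAdjoint.all α).algebraMap (H →L[ℂ] H))
    simpa using this
  exact ⟨hsa, (spectrum_subset_Icc_iff hsa).mpr ⟨hlow, hup⟩⟩

theorem POVM.IsProbability.jensen {ν : POVM X H} (hν : ν.IsProbability) {J : Set ℝ} {α β : ℝ}
    (hJ : IsOpen J) (hJc : J.OrdConnected) (hαβ : Set.Icc α β ⊆ J) {ψ : X → (H →L[ℂ] H)}
    (hψ : Measurable ψ) (hsp : ∀ x, IsSelfAdjoint (ψ x) ∧ spectrum ℝ (ψ x) ⊆ Set.Icc α β)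
    {ϑ : ℝ → ℝ} (hϑ : OperatorConvexOn J ϑ) :
    ν.IsIntegrable ψ ∧ ν.IsIntegrable (fun x => cfc ϑ (ψ x)) ∧
      cfc ϑ (ν.integral ψ) ≤ ν.integral (fun x => cfc ϑ (ψ x)) := by
  let S : Set (H →L[ℂ] H) := {a | IsSelfAdjoint a ∧ spectrum ℝ a ⊆ Set.Icc α β}
  have hS : IsCompact S := isCompact_setOf_spectrum_subset_Icc α β
  have hcont : ContinuousOn (cfc ϑ) S :=
    continuousOn_cfc (H →L[ℂ] H) isCompact_Icc ϑ
      (((hϑ.convexOn hJc).continuousOn hJ).mono hαβ)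
  have hi₁ : ν.IsIntegrable ψ := ν.isIntegrable_of_mem_compact hψ hS hsp continuousOn_id
  have hi₂ : ν.IsIntegrable fun x => cfc ϑ (ψ x) :=
    ν.isIntegrable_of_mem_compact hψ hS hsp hcont
  refine ⟨hi₁, hi₂, ?_⟩
  have hi₃ := ν.isIntegrable_const 1
  have : IsProbabilityMeasure ν.traceMeasure := hν.isProbabilityMeasure
  have : ProperSpace (H →L[ℂ] H) := FiniteDimensional.proper ℂ _
  have : FiniteDimensional ℝ (H →L[ℂ] H) := FiniteDimensional.complexToReal _
  let R : Set (H →L[ℂ] H) := {s | 0 ≤ s} ∩ Metric.closedBall 0 √(Module.finrank ℂ H)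
  have hR : IsCompact R :=
    (isCompact_closedBall _ _).inter_left CStarAlgebra.isClosed_nonneg
  -- The third coordinate carries the normalisation: its integral is `E[1] = 1`, which becomes `∑
  -- b_i* b_i = 1`.
  let G : (H →L[ℂ] H) × (H →L[ℂ] H) → (H →L[ℂ] H) × (H →L[ℂ] H) × (H →L[ℂ] H) :=
    fun p => (p.2 * p.1 * p.2, p.2 * cfc ϑ p.1 * p.2, p.2 * 1 * p.2)
  have hG : ContinuousOn G (S ×ˢ R) := by
    have h2 : ContinuousOn (fun p : (H →L[ℂ] H) × (H →L[ℂ] H) => p.2) (S ×ˢ R) :=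
      continuousOn_snd
    have h1 : ContinuousOn (fun p : (H →L[ℂ] H) × (H →L[ℂ] H) => p.1) (S ×ˢ R) :=
      continuousOn_fst
    have h3 : ContinuousOn (fun p : (H →L[ℂ] H) × (H →L[ℂ] H) => cfc ϑ p.1) (S ×ˢ R) :=
      hcont.comp h1 fun p hp => hp.1
    exact ((h2.mul h1).mul h2).prodMk
      (((h2.mul h3).mul h2).prodMk ((h2.mul continuousOn_const).mul h2))
  have hhull := isCompact_convexHull_of_finiteDimensional
    ((hS.prod hR).image_of_continuousOn hG)
  have j₁ := (ν.isIntegrable_iff.mp hi₁).2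
  have j₂ := (ν.isIntegrable_iff.mp hi₂).2
  have j₃ := (ν.isIntegrable_iff.mp hi₃).2
  -- The mean over a probability measure lies in the closed convex hull. Here the hull is itself
  -- closed, being compact, so the mean is an exact finite convex combination.
  have hmem := (convex_convexHull ℝ (G '' (S ×ˢ R))).integral_mem (μ := ν.traceMeasure)
    (f := fun x => (ν.sandwich ψ x, ν.sandwich (fun x => cfc ϑ (ψ x)) x,
      ν.sandwich (fun _ => 1) x)) hhull.isClosed (by
    filter_upwards [ν.ae_norm_sqrt_le] with x hx
    exact subset_convexHull ℝ _ ⟨(ψ x, CFC.sqrt (ν.rnDeriv x)),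
      ⟨hsp x, (CFC.sqrt_nonneg (ν.rnDeriv x) :), by simpa using hx⟩, rfl⟩) (j₁.prodMk (j₂.prodMk j₃))
  rw [integral_pair j₁ (j₂.prodMk j₃), integral_pair j₂ j₃, ← ν.integral_eq hi₁,
    ← ν.integral_eq hi₂, ← ν.integral_eq hi₃, hν.integral_one,
    mem_convexHull_iff_exists_fintype] at hmem
  obtain ⟨ι, _, w, z, hw, hw1, hz, hsum⟩ := hmem
  choose p hp hpz using hz
  let b : ι → (H →L[ℂ] H) := fun i => √(w i) • (p i).2
  have hb : ∀ i (c : H →L[ℂ] H), star (b i) * c * b i = w i • ((p i).2 * c * (p i).2) := by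
    intro i c
    have hsa : IsSelfAdjoint (p i).2 := IsSelfAdjoint.of_nonneg (hp i).2.1
    have hbsa : star (b i) = b i := ((IsSelfAdjoint.all √(w i)).smul hsa).star_eq
    rw [hbsa]
    simp only [b]
    rw [smul_mul_assoc, smul_mul_smul_comm, Real.mul_self_sqrt (hw i)]
  simp only [← hpz, G, Prod.smul_mk] at hsum
  simp only [Prod.ext_iff, Prod.fst_sum, Prod.snd_sum, ← hb, mul_one] at hsum
  obtain ⟨e1, e2, e3⟩ := hsum
  have e3' : ∑ i, star (b i) * b i = 1 := by
    rw [← e3]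
    exact Finset.sum_congr rfl fun i _ => by simpa using hb i 1
  rw [← e1, ← e2]
  exact hϑ.sum_le hαβ (fun i => (hp i).1.1) (fun i => (hp i).1.2) e3'

end Jensen

end QuantumExpectation

end

theorem mainTheorem6 {X H : Type*} [TopologicalSpace X] [CompactSpace X] [T2Space X]
    [MeasurableSpace X] [BorelSpace X] [NormedAddCommGroup H] [InnerProductSpace ℂ H]
    [CompleteSpace H] [FiniteDimensional ℂ H]
    (ν : QuantumExpectation.POVM X H) (hν : ν.IsProbability) :
    -- generalised linearity
    (∀ ψ₁ ψ₂ : X → (H →L[ℂ] H), ν.IsIntegrable ψ₁ → ν.IsIntegrable ψ₂ →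
      ∀ ϱ₁ ϱ₂ : H →L[ℂ] H,
        (∀ᵐ x ∂ν.traceMeasure, Commute ϱ₁ (ν.rnDeriv x)) →
        (∀ᵐ x ∂ν.traceMeasure, Commute ϱ₂ (ν.rnDeriv x)) →
        ν.IsIntegrable (fun x => ϱ₁ * ψ₁ x + ϱ₂ * ψ₂ x) ∧
        ν.expectation (fun x => ϱ₁ * ψ₁ x + ϱ₂ * ψ₂ x) =
          ϱ₁ * ν.expectation ψ₁ + ϱ₂ * ν.expectation ψ₂) ∧
    -- monotonicity
    (∀ ψ : X → (H →L[ℂ] H), ν.IsIntegrable ψ → (∀ᵐ x ∂ν.traceMeasure, 0 ≤ ψ x) →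
      0 ≤ ν.expectation ψ) ∧
    -- additivity
    (∀ ψ : X → (H →L[ℂ] H), ν.IsIntegrable ψ →
      ∀ E F : Set X, MeasurableSet E → MeasurableSet F → E ∩ F = ∅ →
        ν.IsIntegrable ((E ∪ F).indicator ψ) ∧ ν.IsIntegrable (E.indicator ψ) ∧
        ν.IsIntegrable (F.indicator ψ) ∧
        ν.expectation ((E ∪ F).indicator ψ) =
          ν.expectation (E.indicator ψ) + ν.expectation (F.indicator ψ)) ∧
    -- finitely supported measures
    (∀ ψ : X → (H →L[ℂ] H), QuantumExpectation.IsQuantumRandomVariable ψ →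
      ∀ (n : ℕ) (x : Fin n → X), Function.Injective x → ν.IsSupportedOn (Set.range x) →
        ν.IsIntegrable ψ ∧
        ν.expectation ψ = ∑ j, CFC.sqrt (ν {x j}) * ψ (x j) * CFC.sqrt (ν {x j})) ∧
    -- complete positivity
    ((∀ f : C(X, H →L[ℂ] H), ν.IsIntegrable f) ∧
      QuantumExpectation.IsUnitalCompletelyPositive
        (fun f : C(X, H →L[ℂ] H) => ν.expectation f)) ∧
    -- Jensen's inequality
    (∀ (J : Set ℝ) (α β : ℝ), IsOpen J → J.OrdConnected → Set.Icc α β ⊆ J →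
      ∀ ψ : X → (H →L[ℂ] H), QuantumExpectation.IsQuantumRandomVariable ψ →
        (∀ x, IsSelfAdjoint (ψ x) ∧ spectrum ℝ (ψ x) ⊆ Set.Icc α β) →
        ∀ ϑ : ℝ → ℝ, QuantumExpectation.OperatorConvexOn J ϑ →
          ν.IsIntegrable ψ ∧ ν.IsIntegrable (fun x => cfc ϑ (ψ x)) ∧
          IsSelfAdjoint (ν.expectation ψ) ∧ spectrum ℝ (ν.expectation ψ) ⊆ Set.Icc α β ∧
          cfc ϑ (ν.expectation ψ) ≤ ν.expectation (fun x => cfc ϑ (ψ x))) ∧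
    -- quantum expectation of constant functions
    ((∀ z : H →L[ℂ] H, ν.IsIntegrable (fun _ => z)) ∧
      QuantumExpectation.IsUnitalQuantumChannel
        (fun z : H →L[ℂ] H => ν.expectation (fun _ => z)) ∧
      ∀ ρ : H →L[ℂ] H, QuantumExpectation.IsState ρ →
        QuantumExpectation.IsState (ν.expectation (fun _ => ρ))) ∧
    -- fixed points
    (∃ S : StarSubalgebra ℂ (H →L[ℂ] H), IsClosed (S : Set (H →L[ℂ] H)) ∧
      (S : Set (H →L[ℂ] H)) = ν.fixedPoints) ∧
    -- ergodic property
    (∃ 𝓔 𝔈 : (H →L[ℂ] H) →L[ℂ] (H →L[ℂ] H),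
      (∀ z, 𝓔 z = ν.expectation (fun _ => z)) ∧
      QuantumExpectation.IsConditionalExpectation 𝔈 ∧
      (∀ z, QuantumExpectation.opTrace (𝔈 z) = QuantumExpectation.opTrace z) ∧
      Set.range 𝔈 = ν.fixedPoints ∧
      Tendsto (fun N : ℕ => (N : ℂ)⁻¹ • (1 + ∑ j ∈ Finset.Ico 1 N, 𝓔 ^ j)) atTop (𝓝 𝔈)) := by
  have hcl := ν.isClosed_fixedPointsStarSubalgebra hν
  obtain ⟨P, hP, hPtr, hPrange, hPlim⟩ := hν.exists_ergodic
  refine ⟨fun ψ₁ ψ₂ h₁ h₂ ϱ₁ ϱ₂ hc₁ hc₂ => ν.integral_generalised_linear h₁ h₂ hc₁ hc₂,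
    fun ψ hψ h => ν.integral_nonneg hψ h,
    fun ψ hψ E F hE hF hEF => ⟨hψ.indicator (hE.union hF), hψ.indicator hE, hψ.indicator hF,
      ν.integral_indicator_union hψ hE hF hEF⟩,
    fun ψ hψ n x hx hs => ν.integral_of_isSupportedOn_range
      (QuantumExpectation.isQuantumRandomVariable_iff_measurable.mp hψ) hx hs,
    ⟨ν.isIntegrable_continuousMap, hν.isUnitalCompletelyPositive_continuousMap⟩,
    fun J α β hJ hJc hαβ ψ hψ hsp ϑ hϑ => ?_,
    ⟨ν.isIntegrable_const, hν.isUnitalQuantumChannel, fun ρ hρ => hν.isState_integral_const hρ⟩,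
    ⟨ν.fixedPointsStarSubalgebra hν, hcl, rfl⟩,
    ⟨ν.channel, P, ν.channel_apply, hP, hPtr, hPrange, hPlim⟩⟩
  obtain ⟨h₁, h₂, h₃⟩ := hν.jensen hJ hJc hαβ
    (QuantumExpectation.isQuantumRandomVariable_iff_measurable.mp hψ) hsp hϑ
  obtain ⟨hsa, hspec⟩ := hν.spectrum_integral_subset h₁ hsp
  exact ⟨h₁, h₂, hsa, hspec, h₃⟩
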